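/- Let $d\ge 1$ be an integer, $\nu>0$, $\alpha>0$, and let $K_\nu$ be the modified Bessel function of the second kind, i.e. $K_\nu(x)=\frac{\sqrt\pi}{\Gamma(\nu+1/2)}\left(\frac x2\right)^\nu\int_1^\infty e^{-xt}(t^2-1)^{\nu-1/2}\,dt$ for $x>0$. Let $C_0$ be the Whittle–Matérn covariance function $$C_0(x)=\rho\,\frac{2^{1-\nu}}{\Gamma(\nu)}\,\|x/\alpha\|^\nu K_\nu(\|x/\alpha\|),\quad x\in\mathbb R^d\setminus\{0\},\qquad C_0(0)=\rho,$$ where $\|\cdot\|$ is the Euclidean norm and $$0\le\rho\le\rho_{\max}=\frac{\Gamma(\nu)}{\Gamma(\nu+d/2)(2\sqrt\pi\,\alpha)^d}.$$ Let $\varphi(y)=\int_{\mathbb R^d}C_0(t)e^{-2\pi i\,y\cdot t}\,dt$ and $C_{\mathrm{app},0}(u)=\sum_{k\in\mathbb Z^d}\varphi(k)e^{2\pi i\,k\cdot u}$. Put $$\beta=\left(\alpha\sqrt d\,\max\{\Gamma(1+2\nu)^{1/(2\nu)},1\}\right)^{-1},$$ $$c(\rho,\nu,\alpha,d)=\begin{cases}(4\alpha)^{1-2\nu}\rho^2\pi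 d/\Gamma(\nu)^2&\text{if }\nu\le\frac12,\\ 4\nu^2\rho^2d&\text{if }\nu\ge\frac12,\end{cases}$$ $$\epsilon(\nu,\alpha,1)=\frac{e^{-\beta}}{\beta}+\frac{2e^{-\beta}}{1-e^{-\beta}}\left(\frac{e^{-\beta}}{\beta}+\frac1{1-e^{-\beta}}-1\right),$$ and, for $d\ge2$, $$\epsilon(\nu,\alpha,d)=e^{-\beta}\left(\frac1\beta+\frac2{(1-e^{-\beta})^2}-\frac12\right)\left(\frac1\beta+\frac{2e^{-\beta}}{1-e^{-\beta}}\left(\frac1\beta+\frac1{1-e^{-\beta}}\right)\right)^{d-1}.$$ Then $C_0$ is integrable on $\mathbb R^d$, the series defining $C_{\mathrm{app},0}(u)$ converges absolutely for every $u\in\mathbb R^d$, $|C_0-C_{\mathrm{app},0}|^2$ is integrable on $[-1/2,1/2]^d$, and $$\int_{[-1/2,1/2]^d}|C_0(x)-C_{\mathrm{app},0}(x)|^2\,dx\le c(\rho,\nu,\alpha,d)\,\epsilon(\nu,\alpha,d).$$ -/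

import Mathlib

open MeasureTheory
open scoped FourierTransform

noncomputable section

namespace WhittleMatern

/-- The modified Bessel function of the second kind `K_ν(x)`, for `ν > 0` and `x > 0`, through
its integral representation over `(1, ∞)`. -/
def besselK (ν x : ℝ) : ℝ :=
  Real.sqrt Real.pi / Real.Gamma (ν + 1 / 2) * (x / 2) ^ ν *
    ∫ t in Set.Ioi (1 : ℝ), Real.exp (-(x * t)) * (t ^ 2 - 1) ^ (ν - 1 / 2)

/-- The Whittle–Matérn covariance function with intensity `ρ`, shape `ν` and scale `α`;
its value at the origin is the limit `ρ`. -/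
def cov (d : ℕ) (ρ ν α : ℝ) (x : EuclideanSpace ℝ (Fin d)) : ℝ :=
  if x = 0 then ρ
  else ρ * (2 ^ (1 - ν) / Real.Gamma ν) * ‖α⁻¹ • x‖ ^ ν * besselK ν ‖α⁻¹ • x‖

/-- The maximal intensity. -/
def rhoMax (d : ℕ) (ν α : ℝ) : ℝ :=
  Real.Gamma ν / (Real.Gamma (ν + d / 2) * (2 * Real.sqrt Real.pi * α) ^ d)

/-- The spectral density `φ(y) = ∫ C₀(t) e^{-2πi y·t} dt`. -/
def spectralDensity (d : ℕ) (ρ ν α : ℝ) : EuclideanSpace ℝ (Fin d) → ℂ :=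
  𝓕 (fun t : EuclideanSpace ℝ (Fin d) => (cov d ρ ν α t : ℂ))

/-- An integer vector as a point of Euclidean space. -/
def latticePoint {d : ℕ} (k : Fin d → ℤ) : EuclideanSpace ℝ (Fin d) :=
  WithLp.toLp 2 fun i => (k i : ℝ)

/-- The `k`-th term `φ(k) e^{2πi k·u}` of the Fourier approximation. -/
def appTerm (d : ℕ) (ρ ν α : ℝ) (u : EuclideanSpace ℝ (Fin d)) (k : Fin d → ℤ) : ℂ :=
  spectralDensity d ρ ν α (latticePoint k) *
    Complex.exp (2 * Real.pi * Complex.I * (∑ i, (k i : ℝ) * u i : ℝ))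

/-- The Fourier approximation `C_{app,0}(u) = ∑_{k ∈ ℤ^d} φ(k) e^{2πi k·u}`. -/
def covApp (d : ℕ) (ρ ν α : ℝ) (u : EuclideanSpace ℝ (Fin d)) : ℂ :=
  ∑' k : Fin d → ℤ, appTerm d ρ ν α u k

/-- The unit cube `[-1/2, 1/2]^d`. -/
def unitCube (d : ℕ) : Set (EuclideanSpace ℝ (Fin d)) :=
  {x | ∀ i, x i ∈ Set.Icc (-(1 / 2) : ℝ) (1 / 2)}

/-- `β = (α √d (Γ(1+2ν)^{1/(2ν)} ∨ 1))⁻¹`. -/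
def beta (d : ℕ) (ν α : ℝ) : ℝ :=
  (α * Real.sqrt d * max (Real.Gamma (1 + 2 * ν) ^ (1 / (2 * ν))) 1)⁻¹

/-- The constant `c(ρ, ν, α, d)`; its two formulas agree at `ν = 1/2`. -/
def errorConst (d : ℕ) (ρ ν α : ℝ) : ℝ :=
  if ν ≤ 1 / 2 then (4 * α) ^ (1 - 2 * ν) * ρ ^ 2 * Real.pi * d / Real.Gamma ν ^ 2
  else 4 * ν ^ 2 * ρ ^ 2 * d

/-- `ε(ν, α, 1)` as a function of `β`. -/
def epsOne (b : ℝ) : ℝ :=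
  Real.exp (-b) / b + 2 * Real.exp (-b) / (1 - Real.exp (-b)) *
    (Real.exp (-b) / b + 1 / (1 - Real.exp (-b)) - 1)

/-- `ε(ν, α, d)`, `d ≥ 2`, as a function of `β` and `d`. -/
def epsMulti (d : ℕ) (b : ℝ) : ℝ :=
  Real.exp (-b) * (1 / b + 2 / (1 - Real.exp (-b)) ^ 2 - 1 / 2) *
    (1 / b + 2 * Real.exp (-b) / (1 - Real.exp (-b)) *
      (1 / b + 1 / (1 - Real.exp (-b)))) ^ (d - 1)

/-- `ε(ν, α, d)` for `d ≥ 1`. -/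
def eps (d : ℕ) (ν α : ℝ) : ℝ :=
  if d = 1 then epsOne (beta d ν α) else epsMulti d (beta d ν α)

end WhittleMatern

end

/-!
`C₀` is a mixture of Gaussians: subordinating `exp (-z)` to the inverse Gaussian distribution turns
`K_ν` into an integral of Gaussian kernels, and `C₀(x)` becomes the mean of
`ρ exp (-‖x‖² / (4 α² g))` over a Gamma variable `g` of shape `ν`. So `C₀` and its Fourier transform
are integrals of explicit Gaussians, and Poisson summation for each of them gives
`C_{app,0}(x) = ∑ₙ C₀(x + n)`. The error is therefore the aliasing sum of `C₀(x + n)` over `n ≠ 0`.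

Away from the origin `C₀` decays exponentially, `|C₀(x)| ≤ √(c / d) exp (-β ∑ᵢ |xᵢ|)` as soon as
`‖x‖ ≥ 1 / 2`. For `ν ≤ 1 / 2` this is read off the integral of `K_ν`. For `ν ≥ 1 / 2` it follows
from Alzer's inequality between the incomplete Gamma function and a power of `1 - exp (-b r)`.

With `S(x) = ∑ₙ exp (-β |x + n|)` on the line, the aliasing sum is thus at most a multiple of
`∏ᵢ S(xᵢ) - ∏ᵢ exp (-β |xᵢ|)`. For `d = 1` its square has an explicit integral. For `d ≥ 2` the
square is at most `∏ᵢ S(xᵢ)² - ∏ᵢ exp (-β |xᵢ|) S(xᵢ)`, with integral `B ^ d - E ^ d` for explicit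
`0 < E ≤ B`, while `ε(ν, α, d) = A B ^ (d - 1)`. The case `d = 2` of
`B ^ d - E ^ d ≤ d A B ^ (d - 1)` is an elementary estimate in terms of `coth (β / 2)`, and the
other cases follow from it by induction.
-/

noncomputable section

namespace WhittleMatern

open Real Set Filter Topology

/-! ### Inverse Gaussian subordination -/

lemma integrableOn_Ioi_and_integral_of_deriv_nonneg {f f' : ℝ → ℝ} {a l m : ℝ}
    (hderiv : ∀ x ∈ Ioi a, HasDerivAt f (f' x) x) (hnonneg : ∀ x ∈ Ioi a, 0 ≤ f' x)
    (hleft : Tendsto f (𝓝[>] a) (𝓝 l)) (htop : Tendsto f atTop (𝓝 m)) :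
    IntegrableOn f' (Ioi a) ∧ ∫ x in Ioi a, f' x = m - l := by
  have hcont : ContinuousWithinAt (Function.update f a l) (Ici a) a := by
    rwa [continuousWithinAt_update_same, Ici_sdiff_left]
  have hderiv' : ∀ x ∈ Ioi a, HasDerivAt (Function.update f a l) (f' x) x := fun x hx =>
    (hderiv x hx).congr_of_eventuallyEq <| by
      filter_upwards [isOpen_ne.mem_nhds (ne_of_gt hx)] with t ht
      exact Function.update_of_ne ht _ _
  have htop' : Tendsto (Function.update f a l) atTop (𝓝 m) := htop.congr' <| by
    filter_upwards [eventually_ne_atTop a] with t ht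
    exact (Function.update_of_ne ht _ _).symm
  refine ⟨integrableOn_Ioi_deriv_of_nonneg hcont hderiv' hnonneg htop', ?_⟩
  simpa using integral_Ioi_of_hasDerivAt_of_nonneg hcont hderiv' hnonneg htop'

/-- The antiderivative of `exp (-t ^ 2)` vanishing at `0`: the error function without its
normalization `2 / √π`. -/
def gaussPrim (x : ℝ) : ℝ := ∫ t in (0 : ℝ)..x, exp (-t ^ 2)

lemma hasDerivAt_gaussPrim (x : ℝ) : HasDerivAt gaussPrim (exp (-x ^ 2)) x := by
  have hcont : Continuous fun t : ℝ => exp (-t ^ 2) := by fun_prop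
  exact intervalIntegral.integral_hasDerivAt_right (hcont.intervalIntegrable _ _)
    hcont.stronglyMeasurable.stronglyMeasurableAtFilter hcont.continuousAt

lemma tendsto_gaussPrim_atTop : Tendsto gaussPrim atTop (𝓝 (√π / 2)) := by
  have hint : IntegrableOn (fun t : ℝ => exp (-t ^ 2)) (Ioi 0) := by
    simpa using (integrable_exp_neg_mul_sq one_pos).integrableOn
  have hval : ∫ t in Ioi (0 : ℝ), exp (-t ^ 2) = √π / 2 := by simpa using integral_gaussian_Ioi 1
  exact hval ▸ intervalIntegral_tendsto_integral_Ioi 0 hint tendsto_id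

lemma gaussPrim_neg (x : ℝ) : gaussPrim (-x) = -gaussPrim x := by
  have hreflect := intervalIntegral.integral_comp_neg (a := 0) (b := x) fun t : ℝ => exp (-t ^ 2)
  simp only [even_two, Even.neg_pow, neg_zero] at hreflect
  rw [gaussPrim, gaussPrim, hreflect, intervalIntegral.integral_symm]

lemma tendsto_gaussPrim_atBot : Tendsto gaussPrim atBot (𝓝 (-(√π / 2))) :=
  (tendsto_gaussPrim_atTop.comp tendsto_neg_atBot_atTop).neg.congr fun x => by
    simp [gaussPrim_neg]

/-- An antiderivative on `(0, ∞)` of `z / 2` times the inverse Gaussian kernel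
`s ^ (-3 / 2) * exp (-s - z ^ 2 / (4 * s))`. -/
def inverseGaussianPrim (z s : ℝ) : ℝ :=
  exp (-z) * gaussPrim (√s - z / (2 * √s)) - exp z * gaussPrim (√s + z / (2 * √s))

lemma hasDerivAt_div_two_mul_sqrt {z s : ℝ} (hs : 0 < s) :
    HasDerivAt (fun s => z / (2 * √s)) (-(z / (4 * (s * √s)))) s := by
  convert! (hasDerivAt_const s z).div ((hasDerivAt_sqrt hs.ne').const_mul 2)
    (mul_ne_zero two_ne_zero (sqrt_ne_zero'.2 hs)) using 1
  have hsq : √s ^ 2 = s := sq_sqrt hs.le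
  field_simp
  rw [hsq]
  ring

lemma hasDerivAt_inverseGaussianPrim {z s : ℝ} (hs : 0 < s) :
    HasDerivAt (inverseGaussianPrim z)
      (z / 2 * (s ^ (-(3 / 2) : ℝ) * exp (-s - z ^ 2 / (4 * s)))) s := by
  have : 0 < √s := sqrt_pos.2 hs
  have hsq : √s ^ 2 = s := sq_sqrt hs.le
  have hsqrt := hasDerivAt_sqrt hs.ne'
  have hdiv := hasDerivAt_div_two_mul_sqrt (z := z) hs
  have hderiv := (((hasDerivAt_gaussPrim _).comp s (hsqrt.sub hdiv)).const_mul (exp (-z))).sub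
    (((hasDerivAt_gaussPrim _).comp s (hsqrt.add hdiv)).const_mul (exp z))
  have hminus : exp (-z) * exp (-(√s - z / (2 * √s)) ^ 2) = exp (-s - z ^ 2 / (4 * s)) := by
    rw [← exp_add]; congr 1; field_simp; rw [hsq]; ring
  have hplus : exp z * exp (-(√s + z / (2 * √s)) ^ 2) = exp (-s - z ^ 2 / (4 * s)) := by
    rw [← exp_add]; congr 1; field_simp; rw [hsq]; ring
  have hpow : s ^ (-(3 / 2) : ℝ) = (s * √s)⁻¹ := by
    rw [sqrt_eq_rpow, ← rpow_one_add' hs.le (by norm_num), ← rpow_neg hs.le]; norm_num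
  convert! hderiv using 1
  simp only [Pi.sub_apply, Pi.add_apply]
  rw [← mul_assoc (exp (-z)), hminus, ← mul_assoc (exp z), hplus, hpow]
  field_simp
  ring

lemma tendsto_inverseGaussianPrim_atTop (z : ℝ) :
    Tendsto (inverseGaussianPrim z) atTop (𝓝 (exp (-z) * (√π / 2) - exp z * (√π / 2))) := by
  have hdiv : Tendsto (fun s : ℝ => z / (2 * √s)) atTop (𝓝 0) :=
    tendsto_const_nhds.div_atTop (tendsto_sqrt_atTop.const_mul_atTop two_pos)
  refine .sub (.const_mul _ (tendsto_gaussPrim_atTop.comp ?_))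
    (.const_mul _ (tendsto_gaussPrim_atTop.comp ?_))
  · simpa [sub_eq_add_neg] using tendsto_sqrt_atTop.atTop_add hdiv.neg
  · exact tendsto_sqrt_atTop.atTop_add hdiv

lemma tendsto_inverseGaussianPrim_zero {z : ℝ} (hz : 0 < z) :
    Tendsto (inverseGaussianPrim z) (𝓝[>] 0) (𝓝 (exp (-z) * -(√π / 2) - exp z * (√π / 2))) := by
  have hsqrt : Tendsto (fun s : ℝ => √s) (𝓝[>] 0) (𝓝[>] 0) := by
    refine tendsto_nhdsWithin_iff.2 ⟨?_, ?_⟩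
    · simpa using (continuous_sqrt.tendsto 0).mono_left nhdsWithin_le_nhds
    · filter_upwards [self_mem_nhdsWithin] with s hs using sqrt_pos.2 hs
  have hdiv : Tendsto (fun s : ℝ => z / (2 * √s)) (𝓝[>] 0) atTop :=
    ((tendsto_inv_nhdsGT_zero.comp hsqrt).const_mul_atTop (half_pos hz)).congr fun s => by
      simp only [Function.comp]; ring
  have hsqrt' := tendsto_nhds_of_tendsto_nhdsWithin hsqrt
  exact .sub (.const_mul _ (tendsto_gaussPrim_atBot.comp
      (hsqrt'.add_atBot (tendsto_neg_atTop_atBot.comp hdiv))))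
    (.const_mul _ (tendsto_gaussPrim_atTop.comp (hsqrt'.add_atTop hdiv)))

lemma exp_neg_eq_lintegral_inverseGaussian {z : ℝ} (hz : 0 < z) :
    ENNReal.ofReal (exp (-z)) = ∫⁻ s in Ioi (0 : ℝ),
      ENNReal.ofReal (z / (2 * √π) * (s ^ (-(3 / 2) : ℝ) * exp (-s - z ^ 2 / (4 * s)))) := by
  obtain ⟨hint, hval⟩ := integrableOn_Ioi_and_integral_of_deriv_nonneg
    (fun s hs => hasDerivAt_inverseGaussianPrim (z := z) hs)
    (fun s (hs : 0 < s) => by positivity)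
    (tendsto_inverseGaussianPrim_zero hz) (tendsto_inverseGaussianPrim_atTop z)
  have hrescale (s : ℝ) : z / (2 * √π) * (s ^ (-(3 / 2) : ℝ) * exp (-s - z ^ 2 / (4 * s))) =
      (√π)⁻¹ * (z / 2 * (s ^ (-(3 / 2) : ℝ) * exp (-s - z ^ 2 / (4 * s)))) := by ring
  simp_rw [hrescale]
  rw [← ofReal_integral_eq_lintegral_ofReal (hint.const_mul _), integral_const_mul, hval]
  · congr 1
    field_simp
    ring
  · filter_upwards [ae_restrict_mem measurableSet_Ioi] with s hs
    have : 0 < s := hs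
    positivity

/-! ### The Bessel function as a mixture of Gaussian kernels -/

lemma integrableOn_rpow_mul_exp_neg_mul {a r : ℝ} (ha : 0 < a) (hr : 0 < r) :
    IntegrableOn (fun t : ℝ => t ^ (a - 1) * exp (-(r * t))) (Ioi 0) := by
  refine Integrable.of_integral_ne_zero ?_
  rw [integral_rpow_mul_exp_neg_mul_Ioi ha hr]
  have := Gamma_pos_of_pos ha
  positivity

lemma lintegral_rpow_mul_exp_neg_mul {a r : ℝ} (ha : 0 < a) (hr : 0 < r) :
    ∫⁻ t in Ioi (0 : ℝ), ENNReal.ofReal (t ^ (a - 1) * exp (-(r * t))) =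
      ENNReal.ofReal (r ^ (-a) * Gamma a) := by
  rw [← ofReal_integral_eq_lintegral_ofReal (integrableOn_rpow_mul_exp_neg_mul ha hr),
    integral_rpow_mul_exp_neg_mul_Ioi ha hr, one_div, inv_rpow hr.le, rpow_neg hr.le]
  filter_upwards [ae_restrict_mem measurableSet_Ioi] with t ht
  have : 0 < t := ht
  positivity

lemma image_sq_sub_one_Ioi_one : (fun t : ℝ => t ^ 2 - 1) '' Ioi 1 = Ioi 0 := by
  ext w
  simp only [mem_image, mem_Ioi]
  refine ⟨?_, fun hw => ⟨√(w + 1), ?_, ?_⟩⟩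
  · rintro ⟨t, ht, rfl⟩
    nlinarith
  · rw [lt_sqrt zero_le_one]; linarith
  · rw [sq_sqrt (by linarith)]; ring

lemma lintegral_mul_sq_sub_one_rpow_mul_exp {c m : ℝ} (hc : 0 < c) (hm : 0 < m) :
    ∫⁻ t in Ioi (1 : ℝ), ENNReal.ofReal (t * (t ^ 2 - 1) ^ (m - 1) * exp (-(c * t ^ 2))) =
      ENNReal.ofReal (exp (-c) / 2 * (c ^ (-m) * Gamma m)) := by
  have hderiv : ∀ t ∈ Ioi (1 : ℝ), HasDerivWithinAt (fun t : ℝ => t ^ 2 - 1) (2 * t) (Ioi 1) t :=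
    fun t _ => by simpa using ((hasDerivAt_pow 2 t).sub_const 1).hasDerivWithinAt
  have hmono : MonotoneOn (fun t : ℝ => t ^ 2 - 1) (Ioi 1) := fun s (hs : 1 < s) t _ hst => by
    dsimp only; gcongr
  have hsubst := lintegral_image_eq_lintegral_deriv_mul_of_monotoneOn measurableSet_Ioi
    hderiv hmono fun w =>
      ENNReal.ofReal (exp (-c) / 2) * ENNReal.ofReal (w ^ (m - 1) * exp (-(c * w)))
  rw [image_sq_sub_one_Ioi_one, lintegral_const_mul' _ _ ENNReal.ofReal_ne_top,
    lintegral_rpow_mul_exp_neg_mul hm hc, ← ENNReal.ofReal_mul (by positivity)] at hsubst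
  rw [hsubst]
  refine setLIntegral_congr_fun measurableSet_Ioi fun t (ht : 1 < t) => ?_
  have : 0 < t ^ 2 - 1 := by nlinarith
  rw [← ENNReal.ofReal_mul (by positivity), ← ENNReal.ofReal_mul (by positivity)]
  congr 1
  rw [show -(c * t ^ 2) = -c + -(c * (t ^ 2 - 1)) by ring, exp_add]
  ring

lemma lintegral_sq_sub_one_rpow_mul_inverseGaussian {x m s : ℝ} (hx : 0 < x) (hm : 0 < m)
    (hs : 0 < s) :
    ∫⁻ t in Ioi (1 : ℝ), ENNReal.ofReal ((t ^ 2 - 1) ^ (m - 1) *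
        ((x * t) / (2 * √π) * (s ^ (-(3 / 2) : ℝ) * exp (-s - (x * t) ^ 2 / (4 * s))))) =
      ENNReal.ofReal (x / (4 * √π) * (x ^ 2 / 4) ^ (-m) * Gamma m *
        (s ^ (m - 3 / 2) * exp (-s - x ^ 2 / (4 * s)))) := by
  have hfactor (t : ℝ) : (t ^ 2 - 1) ^ (m - 1) *
        ((x * t) / (2 * √π) * (s ^ (-(3 / 2) : ℝ) * exp (-s - (x * t) ^ 2 / (4 * s)))) =
      x / (2 * √π) * (s ^ (-(3 / 2) : ℝ) * exp (-s)) *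
        (t * (t ^ 2 - 1) ^ (m - 1) * exp (-(x ^ 2 / (4 * s) * t ^ 2))) := by
    rw [show -s - (x * t) ^ 2 / (4 * s) = -s + -(x ^ 2 / (4 * s) * t ^ 2) by ring, exp_add]
    ring
  have hpow : (x ^ 2 / (4 * s)) ^ (-m) = (x ^ 2 / 4) ^ (-m) * s ^ m := by
    rw [← div_div, div_rpow (by positivity) hs.le, rpow_neg hs.le m, div_inv_eq_mul]
  simp_rw [hfactor, ENNReal.ofReal_mul (show 0 ≤ x / (2 * √π) *
    (s ^ (-(3 / 2) : ℝ) * exp (-s)) by positivity)]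
  rw [lintegral_const_mul' _ _ ENNReal.ofReal_ne_top,
    lintegral_mul_sq_sub_one_rpow_mul_exp (by positivity) hm, ← ENNReal.ofReal_mul (by positivity),
    hpow, sub_eq_add_neg (-s), exp_add, sub_eq_add_neg m, rpow_add hs]
  congr 1
  ring

lemma lintegral_exp_neg_mul_sq_sub_one_rpow {x m : ℝ} (hx : 0 < x) (hm : 0 < m) :
    ∫⁻ t in Ioi (1 : ℝ), ENNReal.ofReal (exp (-(x * t)) * (t ^ 2 - 1) ^ (m - 1)) =
      ∫⁻ s in Ioi (0 : ℝ), ENNReal.ofReal (x / (4 * √π) * (x ^ 2 / 4) ^ (-m) * Gamma m *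
        (s ^ (m - 3 / 2) * exp (-s - x ^ 2 / (4 * s)))) := by
  calc
    _ = ∫⁻ t in Ioi (1 : ℝ), ∫⁻ s in Ioi (0 : ℝ), ENNReal.ofReal ((t ^ 2 - 1) ^ (m - 1) *
        ((x * t) / (2 * √π) * (s ^ (-(3 / 2) : ℝ) * exp (-s - (x * t) ^ 2 / (4 * s))))) := by
      refine setLIntegral_congr_fun measurableSet_Ioi fun t (ht : 1 < t) => ?_
      have hpow : 0 ≤ (t ^ 2 - 1) ^ (m - 1) := rpow_nonneg (by nlinarith) _
      rw [mul_comm, ENNReal.ofReal_mul hpow, exp_neg_eq_lintegral_inverseGaussian (by positivity),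
        ← lintegral_const_mul' _ _ ENNReal.ofReal_ne_top]
      simp_rw [← ENNReal.ofReal_mul hpow]
    _ = ∫⁻ s in Ioi (0 : ℝ), ∫⁻ t in Ioi (1 : ℝ), ENNReal.ofReal ((t ^ 2 - 1) ^ (m - 1) *
        ((x * t) / (2 * √π) * (s ^ (-(3 / 2) : ℝ) * exp (-s - (x * t) ^ 2 / (4 * s))))) := by
      refine lintegral_lintegral_swap (Measurable.aemeasurable ?_)
      unfold Function.uncurry
      fun_prop
    _ = _ := setLIntegral_congr_fun measurableSet_Ioi fun s hs =>
      lintegral_sq_sub_one_rpow_mul_inverseGaussian hx hm hs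

lemma integral_exp_neg_mul_sq_sub_one_rpow {x m : ℝ} (hx : 0 < x) (hm : 0 < m) :
    ∫ t in Ioi (1 : ℝ), exp (-(x * t)) * (t ^ 2 - 1) ^ (m - 1) =
      x / (4 * √π) * (x ^ 2 / 4) ^ (-m) * Gamma m *
        ∫ s in Ioi (0 : ℝ), s ^ (m - 3 / 2) * exp (-s - x ^ 2 / (4 * s)) := by
  have := Gamma_pos_of_pos hm
  rw [← integral_const_mul, integral_eq_lintegral_of_nonneg_ae,
    integral_eq_lintegral_of_nonneg_ae, lintegral_exp_neg_mul_sq_sub_one_rpow hx hm]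
  · filter_upwards [ae_restrict_mem measurableSet_Ioi] with s (hs : 0 < s)
    positivity
  · exact Measurable.aestronglyMeasurable (by fun_prop)
  · filter_upwards [ae_restrict_mem measurableSet_Ioi] with t (ht : 1 < t)
    exact mul_nonneg (exp_pos _).le (rpow_nonneg (by nlinarith) _)
  · exact Measurable.aestronglyMeasurable (by fun_prop)

theorem besselK_eq_integral {ν x : ℝ} (hν : 0 < ν + 1 / 2) (hx : 0 < x) :
    besselK ν x = 1 / 2 * (x / 2) ^ (-ν) *
      ∫ s in Ioi (0 : ℝ), s ^ (ν - 1) * exp (-s - x ^ 2 / (4 * s)) := by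
  have hG := Gamma_pos_of_pos hν
  have hbessel := integral_exp_neg_mul_sq_sub_one_rpow hx hν
  rw [show ν + 1 / 2 - 1 = ν - 1 / 2 by ring, show ν + 1 / 2 - 3 / 2 = ν - 1 by ring] at hbessel
  have hpow : (x / 2) ^ ν * (x / 2) * (x ^ 2 / 4) ^ (-(ν + 1 / 2)) = (x / 2) ^ (-ν) := by
    rw [show x ^ 2 / 4 = (x / 2) ^ (2 : ℝ) by rw [rpow_two]; ring, ← rpow_mul (by positivity),
      ← rpow_add_one (by positivity), ← rpow_add (by positivity)]
    congr 1
    ring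
  rw [besselK, hbessel, ← hpow]
  generalize Gamma (ν + 1 / 2) = G at hG
  field_simp
  norm_num

/-! ### Gaussian mixtures -/

section GaussianMixture

variable {V : Type*} [NormedAddCommGroup V] {μ : Measure ℝ}

/-- The mixture of the Gaussians `exp (-(π / a) * ‖x‖ ^ 2)`, with `a` distributed according
to `μ`. -/
def gaussianMixture (μ : Measure ℝ) (x : V) : ℝ := ∫ a, exp (-(π / a) * ‖x‖ ^ 2) ∂μ

lemma integrable_gaussian_mixand [IsFiniteMeasure μ] (hpos : ∀ᵐ a ∂μ, 0 < a) (x : V) :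
    Integrable (fun a => exp (-(π / a) * ‖x‖ ^ 2)) μ := by
  refine .of_bound (Measurable.aestronglyMeasurable (by fun_prop)) 1 ?_
  filter_upwards [hpos] with a ha
  rw [norm_of_nonneg (exp_pos _).le, exp_le_one_iff, neg_mul, neg_nonpos]
  positivity

variable [InnerProductSpace ℝ V]

/-- The mixture of the Fourier transforms of the Gaussians `exp (-(π / a) * ‖x‖ ^ 2)`: the spectral
density of `gaussianMixture μ`. -/
def spectralMixture (μ : Measure ℝ) (w : V) : ℝ :=
  ∫ a, a ^ (Module.finrank ℝ V / 2 : ℝ) * exp (-(π * a * ‖w‖ ^ 2)) ∂μ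

lemma integrable_spectral_mixand (hpos : ∀ᵐ a ∂μ, 0 < a)
    (hmoment : Integrable (fun a => a ^ (Module.finrank ℝ V / 2 : ℝ)) μ) (w : V) :
    Integrable (fun a => a ^ (Module.finrank ℝ V / 2 : ℝ) * exp (-(π * a * ‖w‖ ^ 2))) μ := by
  refine hmoment.mul_bdd (c := 1) (Measurable.aestronglyMeasurable (by fun_prop)) ?_
  filter_upwards [hpos] with a ha
  rw [norm_of_nonneg (exp_pos _).le, exp_le_one_iff, neg_nonpos]
  positivity

variable [FiniteDimensional ℝ V] [MeasurableSpace V] [BorelSpace V]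

lemma integral_exp_neg_pi_div_mul_sq_norm {a : ℝ} (ha : 0 < a) :
    ∫ x : V, exp (-(π / a) * ‖x‖ ^ 2) = a ^ (Module.finrank ℝ V / 2 : ℝ) := by
  rw [GaussianFourier.integral_rexp_neg_mul_sq_norm (by positivity), div_div_cancel₀ pi_ne_zero]

lemma integrable_exp_neg_pi_div_mul_sq_norm {a : ℝ} (ha : 0 < a) :
    Integrable fun x : V => exp (-(π / a) * ‖x‖ ^ 2) := by
  refine .of_integral_ne_zero ?_
  rw [integral_exp_neg_pi_div_mul_sq_norm ha]
  positivity

lemma fourier_exp_neg_pi_div_mul_sq_norm {a : ℝ} (ha : 0 < a) (w : V) :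
    𝓕 (fun x : V => ((exp (-(π / a) * ‖x‖ ^ 2) : ℝ) : ℂ)) w =
      ((a ^ (Module.finrank ℝ V / 2 : ℝ) * exp (-(π * a * ‖w‖ ^ 2)) : ℝ) : ℂ) := by
  have hre : 0 < ((π / a : ℝ) : ℂ).re := by
    rw [Complex.ofReal_re]
    positivity
  have hfourier := fourier_gaussian_innerProductSpace hre w
  have hπ : (π : ℂ) ≠ 0 := by exact_mod_cast pi_ne_zero
  have ha' : (a : ℂ) ≠ 0 := by exact_mod_cast ha.ne'
  push_cast [Complex.ofReal_cpow ha.le] at hfourier ⊢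
  rw [hfourier]
  congr 2 <;> field_simp

lemma integrable_prod_gaussian_mixand [SFinite μ] (hpos : ∀ᵐ a ∂μ, 0 < a)
    (hmoment : Integrable (fun a => a ^ (Module.finrank ℝ V / 2 : ℝ)) μ) :
    Integrable (fun p : V × ℝ => exp (-(π / p.2) * ‖p.1‖ ^ 2)) (volume.prod μ) := by
  rw [integrable_prod_iff' (Measurable.aestronglyMeasurable (by fun_prop))]
  refine ⟨?_, hmoment.congr ?_⟩
  · filter_upwards [hpos] with a ha using integrable_exp_neg_pi_div_mul_sq_norm ha
  · filter_upwards [hpos] with a ha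
    simp_rw [norm_of_nonneg (exp_pos _).le, integral_exp_neg_pi_div_mul_sq_norm ha]

lemma integrable_gaussianMixture [SFinite μ] (hpos : ∀ᵐ a ∂μ, 0 < a)
    (hmoment : Integrable (fun a => a ^ (Module.finrank ℝ V / 2 : ℝ)) μ) :
    Integrable (gaussianMixture μ : V → ℝ) :=
  (integrable_prod_gaussian_mixand hpos hmoment).integral_prod_left

theorem fourier_gaussianMixture [SFinite μ] (hpos : ∀ᵐ a ∂μ, 0 < a)
    (hmoment : Integrable (fun a => a ^ (Module.finrank ℝ V / 2 : ℝ)) μ) (w : V) :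
    𝓕 (fun x : V => (gaussianMixture μ x : ℂ)) w = spectralMixture μ w := by
  have hint := ((integrable_prod_gaussian_mixand (V := V) hpos hmoment).ofReal (𝕜 := ℂ)).bdd_mul
    (c := 1) (f := fun p => Complex.exp (↑(-2 * π * inner ℝ p.1 w) * Complex.I))
    (Measurable.aestronglyMeasurable (by fun_prop))
    (ae_of_all _ fun p => (Complex.norm_exp_ofReal_mul_I _).le)
  calc 𝓕 (fun x : V => (gaussianMixture μ x : ℂ)) w
      = ∫ x : V, ∫ a, Complex.exp (↑(-2 * π * inner ℝ x w) * Complex.I) *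
          ((exp (-(π / a) * ‖x‖ ^ 2) : ℝ) : ℂ) ∂μ := by
        simp_rw [fourier_eq', gaussianMixture, ← integral_complex_ofReal, smul_eq_mul,
          integral_const_mul]
    _ = ∫ a, (∫ x : V, Complex.exp (↑(-2 * π * inner ℝ x w) * Complex.I) *
          ((exp (-(π / a) * ‖x‖ ^ 2) : ℝ) : ℂ)) ∂μ := integral_integral_swap hint
    _ = spectralMixture μ w := by
        rw [spectralMixture, ← integral_complex_ofReal]
        refine integral_congr_ae ?_
        filter_upwards [hpos] with a ha
        rw [← fourier_exp_neg_pi_div_mul_sq_norm ha w, fourier_eq']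
        rfl

end GaussianMixture

/-! ### Poisson summation -/

section ProductSeries

variable {R β : Type*} [NormedCommRing R]

lemma summable_norm_prod_fin {d : ℕ} {f : Fin d → β → R} (hf : ∀ i, Summable fun n => ‖f i n‖) :
    Summable fun n : Fin d → β => ‖∏ i, f i (n i)‖ := by
  induction d with
  | zero => exact (hasSum_unique _).summable
  | succ d ih =>
    rw [← (Fin.consEquiv fun _ : Fin (d + 1) => β).summable_iff]
    refine ((hf 0).mul_norm (ih fun i => hf i.succ)).congr fun p => ?_
    simp [Fin.prod_univ_succ, Fin.consEquiv]

lemma hasSum_prod_fin [CompleteSpace R] {d : ℕ} {f : Fin d → β → R}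
    (hf : ∀ i, Summable fun n => ‖f i n‖) :
    HasSum (fun n : Fin d → β => ∏ i, f i (n i)) (∏ i, ∑' n, f i n) := by
  induction d with
  | zero => simp
  | succ d ih =>
    have htail : ∀ i : Fin d, Summable fun n => ‖f i.succ n‖ := fun i => hf i.succ
    have htail_prod := summable_norm_prod_fin htail
    have hmul := summable_mul_of_summable_norm (hf 0) htail_prod
    rw [Fin.prod_univ_succ, ← (Fin.consEquiv fun _ : Fin (d + 1) => β).hasSum_iff]
    refine ((hf 0).of_norm.hasSum.mul (ih htail) hmul).congr_fun fun p => ?_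
    simp [Fin.prod_univ_succ, Fin.consEquiv]

end ProductSeries

lemma summable_norm_exp_theta {a : ℝ} (ha : 0 < a) (t : ℝ) :
    Summable fun k : ℤ => ‖Complex.exp (-π * a * k ^ 2 + 2 * π * (Complex.I * t) * k)‖ := by
  refine ((summable_jacobiTheta₂_term_iff (t : ℂ) (Complex.I * a)).2
    (by simpa using ha)).norm.congr fun k => ?_
  unfold jacobiTheta₂_term
  congr 2
  linear_combination (π * a * k ^ 2) * Complex.I_sq

lemma summable_norm_exp_gaussian {a : ℝ} (ha : 0 < a) (t : ℝ) :
    Summable fun n : ℤ => ‖Complex.exp (-π / a * (n + t) ^ 2)‖ := by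
  have him : 0 < (Complex.I / a : ℂ).im := by
    rw [Complex.div_ofReal_im, Complex.I_im]
    positivity
  refine (((summable_jacobiTheta₂_term_iff (Complex.I * t / a : ℂ) _).2 him).norm.mul_left
    ‖Complex.exp (-π / a * t ^ 2)‖).congr fun k => ?_
  have ha' : (a : ℂ) ≠ 0 := by exact_mod_cast ha.ne'
  rw [jacobiTheta₂_term, ← norm_mul, ← Complex.exp_add]
  congr 2
  field_simp
  linear_combination (2 * k * t + k ^ 2 : ℂ) * Complex.I_sq

lemma tsum_exp_gaussian {a : ℝ} (ha : 0 < a) (t : ℝ) :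
    ∑' n : ℤ, Complex.exp (-π / a * (n + t) ^ 2) =
      (√a : ℂ) * ∑' k : ℤ, Complex.exp (-π * a * k ^ 2 + 2 * π * (Complex.I * t) * k) := by
  have hsqrt : (a : ℂ) ^ (1 / 2 : ℂ) = (√a : ℂ) := by
    rw [sqrt_eq_rpow, Complex.ofReal_cpow ha.le]
    norm_num
  have hsqrt_ne : (√a : ℂ) ≠ 0 := by exact_mod_cast (sqrt_pos.2 ha).ne'
  rw [Complex.tsum_exp_neg_quadratic (a := a) (by simpa using ha) (Complex.I * t), hsqrt,
    ← mul_assoc, mul_one_div_cancel hsqrt_ne, one_mul, ← (Equiv.neg ℤ).tsum_eq]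
  refine tsum_congr fun n => ?_
  simp only [Equiv.neg_apply, Int.cast_neg, ← mul_assoc, Complex.I_mul_I]
  ring_nf

section Lattice

variable {d : ℕ}

/-- The character `u ↦ exp (2πi k · u)` of `ℝ ^ d` with frequency `k ∈ ℤ ^ d`. -/
def latticeChar (k : Fin d → ℤ) (u : EuclideanSpace ℝ (Fin d)) : ℂ :=
  Complex.exp (2 * π * Complex.I * (∑ i, (k i : ℝ) * u i : ℝ))

lemma norm_latticeChar (k : Fin d → ℤ) (u : EuclideanSpace ℝ (Fin d)) :
    ‖latticeChar k u‖ = 1 := by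
  rw [latticeChar, show (2 * π * Complex.I * (∑ i, (k i : ℝ) * u i : ℝ) : ℂ) =
    ((2 * π * ∑ i, (k i : ℝ) * u i : ℝ) : ℂ) * Complex.I by push_cast; ring,
    Complex.norm_exp_ofReal_mul_I]

@[fun_prop]
lemma continuous_latticeChar (k : Fin d → ℤ) : Continuous (latticeChar k) := by
  unfold latticeChar
  fun_prop

lemma norm_latticePoint_sq (k : Fin d → ℤ) : ‖latticePoint k‖ ^ 2 = ∑ i, (k i : ℝ) ^ 2 := by
  simp [EuclideanSpace.norm_sq_eq, latticePoint]

lemma tsum_exp_neg_pi_div_mul_norm_add_latticePoint_sq {a : ℝ} (ha : 0 < a)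
    (x : EuclideanSpace ℝ (Fin d)) :
    ∑' n : Fin d → ℤ, ((exp (-(π / a) * ‖x + latticePoint n‖ ^ 2) : ℝ) : ℂ) =
      ∑' k : Fin d → ℤ, ((a ^ (d / 2 : ℝ) * exp (-(π * a * ‖latticePoint k‖ ^ 2)) : ℝ) : ℂ) *
        latticeChar k x := by
  have hspace (n : Fin d → ℤ) : ((exp (-(π / a) * ‖x + latticePoint n‖ ^ 2) : ℝ) : ℂ) =
      ∏ i, Complex.exp (-π / a * (n i + x i) ^ 2) := by
    rw [← Complex.exp_sum, Complex.ofReal_exp, EuclideanSpace.norm_sq_eq, Finset.mul_sum]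
    push_cast
    congr 1
    refine Finset.sum_congr rfl fun i _ => ?_
    simp only [PiLp.add_apply, latticePoint, norm_eq_abs, ← Complex.ofReal_pow, sq_abs]
    push_cast
    ring
  have hpow : ((a ^ (d / 2 : ℝ) : ℝ) : ℂ) = ∏ _i : Fin d, (√a : ℂ) := by
    rw [Finset.prod_const, Finset.card_univ, Fintype.card_fin, ← Complex.ofReal_pow,
      rpow_div_two_eq_sqrt _ ha.le, rpow_natCast]
  have hfreq (k : Fin d → ℤ) :
      ((a ^ (d / 2 : ℝ) * exp (-(π * a * ‖latticePoint k‖ ^ 2)) : ℝ) : ℂ) * latticeChar k x =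
        (∏ _i : Fin d, (√a : ℂ)) *
          ∏ i, Complex.exp (-π * a * k i ^ 2 + 2 * π * (Complex.I * x i) * k i) := by
    rw [Complex.ofReal_mul, hpow, mul_assoc, latticeChar, Complex.ofReal_exp, ← Complex.exp_add,
      ← Complex.exp_sum, norm_latticePoint_sq]
    congr 2
    push_cast
    rw [Finset.mul_sum, Finset.mul_sum, ← Finset.sum_neg_distrib, ← Finset.sum_add_distrib]
    exact Finset.sum_congr rfl fun i _ => by ring
  simp_rw [hspace, hfreq]
  rw [tsum_mul_left, (hasSum_prod_fin fun i => summable_norm_exp_gaussian ha (x i)).tsum_eq,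
    (hasSum_prod_fin fun i => summable_norm_exp_theta ha (x i)).tsum_eq, ← Finset.prod_mul_distrib]
  exact Finset.prod_congr rfl fun i _ => tsum_exp_gaussian ha (x i)

theorem tsum_spectralMixture_mul_latticeChar {μ : Measure ℝ} [IsFiniteMeasure μ]
    (hpos : ∀ᵐ a ∂μ, 0 < a) (hmoment : Integrable (fun a => a ^ (d / 2 : ℝ)) μ)
    (x : EuclideanSpace ℝ (Fin d))
    (hspace : Summable fun n : Fin d → ℤ => gaussianMixture μ (x + latticePoint n))
    (hfreq : Summable fun k : Fin d → ℤ => spectralMixture μ (latticePoint k)) :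
    ∑' k : Fin d → ℤ, (spectralMixture μ (latticePoint k) : ℂ) * latticeChar k x =
      ((∑' n : Fin d → ℤ, gaussianMixture μ (x + latticePoint n) : ℝ) : ℂ) := by
  have hspectral (w : EuclideanSpace ℝ (Fin d)) :
      spectralMixture μ w = ∫ a, a ^ (d / 2 : ℝ) * exp (-(π * a * ‖w‖ ^ 2)) ∂μ := by
    simp [spectralMixture]
  have hspace_int (n : Fin d → ℤ) :
      Integrable (fun a => ((exp (-(π / a) * ‖x + latticePoint n‖ ^ 2) : ℝ) : ℂ)) μ :=
    (integrable_gaussian_mixand hpos (x + latticePoint n)).ofReal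
  have hspace_sum := hasSum_integral_of_summable_integral_norm hspace_int <| by
    refine hspace.congr fun n => ?_
    simp_rw [Complex.norm_real, norm_of_nonneg (exp_pos _).le]
    rfl
  have hfreq_int (k : Fin d → ℤ) : Integrable (fun a => ((a ^ (d / 2 : ℝ) *
      exp (-(π * a * ‖latticePoint k‖ ^ 2)) : ℝ) : ℂ) * latticeChar k x) μ := by
    have hreal : Integrable
        (fun a => a ^ (d / 2 : ℝ) * exp (-(π * a * ‖latticePoint k‖ ^ 2))) μ := by
      simpa using integrable_spectral_mixand hpos (by simpa using hmoment) (latticePoint k)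
    exact hreal.ofReal.mul_const _
  have hfreq_sum := hasSum_integral_of_summable_integral_norm hfreq_int <| by
    refine hfreq.congr fun k => ?_
    rw [hspectral]
    refine integral_congr_ae ?_
    filter_upwards [hpos] with a ha
    rw [norm_mul, norm_latticeChar, mul_one, Complex.norm_real, norm_of_nonneg (by positivity)]
  have hpoisson : ∀ᵐ a ∂μ, ∑' k : Fin d → ℤ, ((a ^ (d / 2 : ℝ) *
        exp (-(π * a * ‖latticePoint k‖ ^ 2)) : ℝ) : ℂ) * latticeChar k x =
      ∑' n : Fin d → ℤ, ((exp (-(π / a) * ‖x + latticePoint n‖ ^ 2) : ℝ) : ℂ) := by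
    filter_upwards [hpos] with a ha
    exact (tsum_exp_neg_pi_div_mul_norm_add_latticePoint_sq ha x).symm
  rw [integral_congr_ae hpoisson, ← hspace_sum.tsum_eq] at hfreq_sum
  simpa only [integral_mul_const, integral_complex_ofReal, ← hspectral, Complex.ofReal_tsum,
    gaussianMixture] using hfreq_sum.tsum_eq

lemma summable_norm_latticePoint_rpow {r : ℝ} (hr : r < -d) :
    Summable fun k : Fin d → ℤ => ‖latticePoint k‖ ^ r := by
  let b := (EuclideanSpace.basisFun (Fin d) ℝ).toBasis
  let e := (b.restrictScalars ℤ).equivFun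
  have hcoe (k : Fin d → ℤ) : (e.symm k : EuclideanSpace ℝ (Fin d)) = latticePoint k := by
    ext i
    simp only [e, b, Module.Basis.equivFun_symm_apply, Submodule.coe_sum, Submodule.coe_smul,
      Module.Basis.restrictScalars_apply]
    simp [latticePoint, Pi.single_apply]
  have hrank : Module.finrank ℤ (Submodule.span ℤ (Set.range b)) = d := by
    simpa using Module.finrank_eq_card_basis (b.restrictScalars ℤ)
  refine (e.symm.toEquiv.summable_iff.2 (ZLattice.summable_norm_rpow
    (Submodule.span ℤ (Set.range b)) r (by rwa [hrank]))).congr fun k => ?_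
  simp [hcoe]

lemma summable_add_mul_norm_latticePoint_sq_rpow {b c p : ℝ} (hb : 0 ≤ b) (hc : 0 < c)
    (hp : (d / 2 : ℝ) < p) :
    Summable fun k : Fin d → ℤ =>
      (b + c * ‖latticePoint k‖ ^ 2) ^ (-p) := by
  refine .of_norm_bounded_eventually ((summable_norm_latticePoint_rpow (d := d) (r := -(2 * p))
    (by linarith)).mul_left (c ^ (-p))) ?_
  filter_upwards [(Set.finite_singleton (0 : Fin d → ℤ)).eventually_cofinite_notMem] with k hk
  have hk' : 0 < ‖latticePoint k‖ := by
    refine norm_pos_iff.2 fun h => hk (funext fun i => ?_)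
    simpa [latticePoint] using congrArg (· i) h
  rw [norm_of_nonneg (by positivity)]
  calc (b + c * ‖latticePoint k‖ ^ 2) ^ (-p) ≤ (c * ‖latticePoint k‖ ^ 2) ^ (-p) :=
        rpow_le_rpow_of_nonpos (by positivity) (by linarith) (by linarith [d.cast_nonneg (α := ℝ)])
    _ = c ^ (-p) * ‖latticePoint k‖ ^ (-(2 * p)) := by
        rw [mul_rpow hc.le (by positivity), ← rpow_natCast_mul hk'.le]
        norm_num

end Lattice

/-! ### Gamma mixtures and the Whittle–Matérn correlation -/

section GammaMeasure

open ProbabilityTheory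

variable {a r : ℝ}

lemma measurable_gammaPDF : Measurable (gammaPDF a r) :=
  (measurable_gammaPDFReal a r).ennreal_ofReal

lemma ae_pos_gammaMeasure : ∀ᵐ t ∂gammaMeasure a r, 0 < t := by
  rw [gammaMeasure, ae_withDensity_iff measurable_gammaPDF]
  filter_upwards [volume.ae_ne 0] with t ht hpdf
  by_contra! hle
  exact hpdf (gammaPDF_of_neg (lt_of_le_of_ne hle ht))

lemma integral_gammaMeasure (ha : 0 < a) (hr : 0 < r) (f : ℝ → ℝ) :
    ∫ t, f t ∂gammaMeasure a r =
      r ^ a / Gamma a * ∫ t in Ioi 0, t ^ (a - 1) * exp (-(r * t)) * f t := by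
  have hpdf : ∀ᵐ t, gammaPDF a r t < ⊤ := .of_forall fun _ => ENNReal.ofReal_lt_top
  rw [gammaMeasure, integral_withDensity_eq_integral_toReal_smul measurable_gammaPDF hpdf,
    ← integral_const_mul, ← integral_Ici_eq_integral_Ioi, ← integral_indicator measurableSet_Ici]
  congr 1 with t
  rw [gammaPDF, ENNReal.toReal_ofReal (gammaPDFReal_nonneg ha hr t), gammaPDFReal, indicator]
  simp only [mem_Ici, smul_eq_mul, ite_mul, zero_mul, mul_assoc]

lemma integral_rpow_mul_exp_neg_mul_gammaMeasure {e κ : ℝ} (ha : 0 < a) (hr : 0 < r)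
    (he : 0 < a + e) (hκ : 0 ≤ κ) :
    ∫ t, t ^ e * exp (-(κ * t)) ∂gammaMeasure a r =
      r ^ a / Gamma a * Gamma (a + e) * (r + κ) ^ (-(a + e)) := by
  have hrκ : 0 < r + κ := by linarith
  have hmoment : ∫ t in Ioi 0, t ^ (a - 1) * exp (-(r * t)) * (t ^ e * exp (-(κ * t))) =
      ∫ t in Ioi 0, t ^ (a + e - 1) * exp (-((r + κ) * t)) := by
    refine setIntegral_congr_fun measurableSet_Ioi fun t (ht : 0 < t) => ?_
    rw [mul_mul_mul_comm, ← rpow_add ht, ← exp_add]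
    ring_nf
  rw [integral_gammaMeasure ha hr, hmoment, integral_rpow_mul_exp_neg_mul_Ioi he hrκ, one_div,
    inv_rpow hrκ.le, rpow_neg hrκ.le, mul_right_comm, mul_assoc]

lemma integrable_rpow_gammaMeasure {e : ℝ} (ha : 0 < a) (hr : 0 < r) (he : 0 < a + e) :
    Integrable (fun t => t ^ e) (gammaMeasure a r) := by
  refine .of_integral_ne_zero ?_
  have := integral_rpow_mul_exp_neg_mul_gammaMeasure ha hr he le_rfl
  simp only [zero_mul, neg_zero, exp_zero, mul_one, add_zero] at this
  rw [this]
  have := Gamma_pos_of_pos ha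
  have := Gamma_pos_of_pos he
  positivity

end GammaMeasure

/-- The Whittle–Matérn correlation at distance `r`, for unit scale and smoothness `ν`. -/
def maternCorr (ν r : ℝ) : ℝ :=
  2 ^ (1 - ν) / Gamma ν * r ^ ν * besselK ν r

/-- The mixing law of the Whittle–Matérn correlation of smoothness `ν` and scale `α`. Its rate
is `(4πα²)⁻¹` because the Gaussian kernels are normalised as `exp (-π‖x‖² / a)`. -/
def maternMixing (ν α : ℝ) : Measure ℝ :=
  ProbabilityTheory.gammaMeasure ν (4 * π * α ^ 2)⁻¹

section Mixing

variable {d : ℕ} {ρ ν α : ℝ}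

lemma cov_of_ne_zero (hα : 0 < α) {x : EuclideanSpace ℝ (Fin d)} (hx : x ≠ 0) :
    cov d ρ ν α x = ρ * maternCorr ν (‖x‖ / α) := by
  rw [cov, if_neg hx, maternCorr, norm_smul, norm_inv, norm_of_nonneg hα.le,
    div_eq_inv_mul ‖x‖]
  ring

lemma maternCorr_eq_integral {r : ℝ} (hν : 0 < ν) (hr : 0 < r) :
    maternCorr ν r = (Gamma ν)⁻¹ * ∫ s in Ioi 0, s ^ (ν - 1) * exp (-s - r ^ 2 / (4 * s)) := by
  have hpow : (2 : ℝ) ^ (1 - ν) * r ^ ν * (r / 2) ^ (-ν) = 2 := by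
    rw [rpow_sub two_pos, rpow_one, rpow_neg (by positivity), div_rpow hr.le two_pos.le]
    field_simp
  rw [maternCorr, besselK_eq_integral (by linarith) hr]
  linear_combination (Gamma ν)⁻¹ / 2 *
    (∫ s in Ioi 0, s ^ (ν - 1) * exp (-s - r ^ 2 / (4 * s))) * hpow

lemma gaussianMixture_maternMixing {V : Type*} [NormedAddCommGroup V] (hν : 0 < ν) (hα : 0 < α)
    {x : V} (hx : x ≠ 0) :
    gaussianMixture (maternMixing ν α) x = maternCorr ν (‖x‖ / α) := by
  have hr : 0 < (4 * π * α ^ 2)⁻¹ := by positivity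
  set r := (4 * π * α ^ 2)⁻¹ with hr_def
  let g (s : ℝ) := s ^ (ν - 1) * exp (-s - (‖x‖ / α) ^ 2 / (4 * s))
  have hsubst : ∫ t in Ioi 0, t ^ (ν - 1) * exp (-(r * t)) * exp (-(π / t) * ‖x‖ ^ 2) =
      r ^ (1 - ν) * ∫ t in Ioi 0, g (r * t) := by
    rw [← integral_const_mul]
    refine setIntegral_congr_fun measurableSet_Ioi fun t (ht : 0 < t) => ?_
    have hpow : r ^ (1 - ν) * r ^ (ν - 1) = 1 := by rw [← rpow_add hr]; simp
    have hexp : -(r * t) - (‖x‖ / α) ^ 2 / (4 * (r * t)) = -(r * t) + -(π / t) * ‖x‖ ^ 2 := by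
      rw [hr_def]
      field_simp
      ring
    simp only [g, mul_rpow hr.le ht.le, hexp, exp_add]
    linear_combination -(t ^ (ν - 1) * exp (-(r * t)) * exp (-(π / t) * ‖x‖ ^ 2)) * hpow
  have hpow : r ^ ν * r ^ (1 - ν) * r⁻¹ = 1 := by
    rw [← rpow_add hr, add_sub_cancel, rpow_one, mul_inv_cancel₀ hr.ne']
  have hcorr : maternCorr ν (‖x‖ / α) = (Gamma ν)⁻¹ * ∫ s in Ioi 0, g s :=
    maternCorr_eq_integral hν (div_pos (norm_pos_iff.2 hx) hα)
  rw [gaussianMixture, maternMixing, integral_gammaMeasure hν hr, hsubst,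
    integral_comp_mul_left_Ioi g 0 hr, mul_zero, smul_eq_mul, hcorr]
  linear_combination (Gamma ν)⁻¹ * (∫ s in Ioi 0, g s) * hpow

lemma isProbabilityMeasure_maternMixing (hν : 0 < ν) (hα : 0 < α) :
    IsProbabilityMeasure (maternMixing ν α) :=
  ProbabilityTheory.isProbabilityMeasure_gammaMeasure hν (by positivity)

lemma ae_pos_maternMixing : ∀ᵐ a ∂maternMixing ν α, 0 < a :=
  ae_pos_gammaMeasure

lemma cov_eq_mul_gaussianMixture (hν : 0 < ν) (hα : 0 < α) :
    cov d ρ ν α = fun x => ρ * gaussianMixture (maternMixing ν α) x := by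
  ext x
  obtain rfl | hx := eq_or_ne x 0
  · have := isProbabilityMeasure_maternMixing hν hα
    simp [cov, gaussianMixture]
  · rw [cov_of_ne_zero hα hx, gaussianMixture_maternMixing hν hα hx]

lemma integrable_rpow_maternMixing (hν : 0 < ν) (hα : 0 < α) :
    Integrable (fun a => a ^ (d / 2 : ℝ)) (maternMixing ν α) :=
  integrable_rpow_gammaMeasure hν (by positivity) (by positivity)

lemma integrable_cov (hν : 0 < ν) (hα : 0 < α) : Integrable (cov d ρ ν α) := by
  have := isProbabilityMeasure_maternMixing hν hα
  rw [cov_eq_mul_gaussianMixture hν hα]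
  exact (integrable_gaussianMixture ae_pos_maternMixing
    (by simpa using integrable_rpow_maternMixing hν hα)).const_mul ρ

lemma spectralDensity_eq (hν : 0 < ν) (hα : 0 < α) (w : EuclideanSpace ℝ (Fin d)) :
    spectralDensity d ρ ν α w = ρ * spectralMixture (maternMixing ν α) w := by
  have := isProbabilityMeasure_maternMixing hν hα
  rw [← fourier_gaussianMixture ae_pos_maternMixing
    (by simpa using integrable_rpow_maternMixing hν hα), spectralDensity,
    cov_eq_mul_gaussianMixture hν hα]
  simp_rw [Complex.ofReal_mul, fourier_eq', smul_eq_mul, mul_left_comm _ (ρ : ℂ),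
    integral_const_mul]

lemma spectralMixture_maternMixing (hν : 0 < ν) (hα : 0 < α) (w : EuclideanSpace ℝ (Fin d)) :
    spectralMixture (maternMixing ν α) w =
      (4 * π * α ^ 2)⁻¹ ^ ν / Gamma ν * Gamma (ν + d / 2) *
        ((4 * π * α ^ 2)⁻¹ + π * ‖w‖ ^ 2) ^ (-(ν + d / 2)) := by
  rw [← integral_rpow_mul_exp_neg_mul_gammaMeasure hν (by positivity) (by positivity)
    (by positivity)]
  simp only [spectralMixture, maternMixing, finrank_euclideanSpace, Fintype.card_fin,
    mul_right_comm]

lemma summable_spectralMixture_latticePoint (hν : 0 < ν) (hα : 0 < α) :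
    Summable fun k : Fin d → ℤ => spectralMixture (maternMixing ν α) (latticePoint k) := by
  simp_rw [spectralMixture_maternMixing hν hα]
  exact (summable_add_mul_norm_latticePoint_sq_rpow (by positivity) pi_pos (by linarith)).mul_left _

lemma norm_appTerm (u : EuclideanSpace ℝ (Fin d)) (k : Fin d → ℤ) :
    ‖appTerm d ρ ν α u k‖ = ‖spectralDensity d ρ ν α (latticePoint k)‖ := by
  rw [show appTerm d ρ ν α u k = spectralDensity d ρ ν α (latticePoint k) * latticeChar k u from
    rfl, norm_mul, norm_latticeChar, mul_one]

lemma summable_norm_spectralDensity (hν : 0 < ν) (hα : 0 < α) :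
    Summable fun k : Fin d → ℤ => ‖spectralDensity d ρ ν α (latticePoint k)‖ := by
  refine ((summable_spectralMixture_latticePoint hν hα).mul_left ρ).norm.congr fun k => ?_
  rw [spectralDensity_eq hν hα, ← Complex.ofReal_mul, Complex.norm_real]

lemma summable_appTerm (hν : 0 < ν) (hα : 0 < α) (u : EuclideanSpace ℝ (Fin d)) :
    Summable (appTerm d ρ ν α u) := by
  refine .of_norm ?_
  simpa only [norm_appTerm] using summable_norm_spectralDensity hν hα

lemma continuous_covApp (hν : 0 < ν) (hα : 0 < α) : Continuous (covApp d ρ ν α) :=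
  continuous_tsum (fun k => continuous_const.mul (continuous_latticeChar k))
    (summable_norm_spectralDensity hν hα) fun k u => (norm_appTerm u k).le

theorem covApp_eq_tsum (hν : 0 < ν) (hα : 0 < α) (x : EuclideanSpace ℝ (Fin d))
    (hspace : Summable fun n : Fin d → ℤ => cov d ρ ν α (x + latticePoint n)) :
    covApp d ρ ν α x = ((∑' n : Fin d → ℤ, cov d ρ ν α (x + latticePoint n) : ℝ) : ℂ) := by
  have := isProbabilityMeasure_maternMixing hν hα
  have happ : covApp d ρ ν α x = ρ * ∑' k : Fin d → ℤ,
      (spectralMixture (maternMixing ν α) (latticePoint k) : ℂ) * latticeChar k x := by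
    simp_rw [← tsum_mul_left, ← mul_assoc, ← spectralDensity_eq hν hα]
    rfl
  rw [happ]
  simp only [cov_eq_mul_gaussianMixture hν hα] at hspace ⊢
  obtain rfl | hρ := eq_or_ne ρ 0
  · simp
  · rw [tsum_spectralMixture_mul_latticeChar ae_pos_maternMixing
      (integrable_rpow_maternMixing hν hα) x ((summable_mul_left_iff hρ).1 hspace)
      (summable_spectralMixture_latticePoint hν hα), tsum_mul_left, Complex.ofReal_mul]

end Mixing

/-! ### Alzer's inequality for the incomplete Gamma function -/

section Alzer

/-- The mean value `∫₀¹ e^{-yt} dt` of the exponential, for `y ≠ 0`. -/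
def expMean (y : ℝ) : ℝ := (1 - exp (-y)) / y

lemma expMean_pos {y : ℝ} (hy : 0 < y) : 0 < expMean y :=
  div_pos (by simpa using hy) hy

lemma integral_exp_neg_mul_Ioc {y : ℝ} (hy : y ≠ 0) :
    ∫ t in Ioc (0 : ℝ) 1, exp (-(y * t)) = expMean y := by
  have h := intervalIntegral.integral_comp_mul_left (a := 0) (b := 1) (fun t => exp t)
    (neg_ne_zero.2 hy)
  simp only [neg_mul, mul_zero, mul_one, integral_exp, smul_eq_mul, exp_zero] at h
  rw [← intervalIntegral.integral_of_le zero_le_one, h, expMean]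
  field_simp
  ring

-- Jensen's inequality for the concave function `x ↦ x ^ θ`.
lemma expMean_mul_le_rpow {y θ : ℝ} (hy : 0 < y) (hθ : 0 < θ) (hθ1 : θ ≤ 1) :
    expMean (θ * y) ≤ expMean y ^ θ := by
  have : IsProbabilityMeasure (volume.restrict (Ioc (0 : ℝ) 1)) := ⟨by simp⟩
  have hint (c : ℝ) : Integrable (fun t => exp (-(c * t))) (volume.restrict (Ioc (0 : ℝ) 1)) :=
    (Continuous.integrableOn_Icc (by fun_prop)).mono_set Ioc_subset_Icc_self
  have hexp (t : ℝ) : exp (-(y * t)) ^ θ = exp (-(θ * y * t)) := by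
    rw [← exp_mul]
    ring_nf
  have hjensen := (concaveOn_rpow hθ.le hθ1).le_map_integral
    (continuousOn_id.rpow_const fun x _ => Or.inr hθ.le) isClosed_Ici
    (ae_of_all (volume.restrict (Ioc (0 : ℝ) 1)) fun t => (exp_pos (-(y * t))).le) (hint y)
    (by simpa only [Function.comp_def, hexp] using hint (θ * y))
  simp only [hexp] at hjensen
  rwa [integral_exp_neg_mul_Ioc hy.ne', integral_exp_neg_mul_Ioc (mul_pos hθ hy).ne'] at hjensen

/-- The lower incomplete Gamma function. -/
def lowerGamma (a r : ℝ) : ℝ := ∫ t in (0 : ℝ)..r, t ^ (a - 1) * exp (-t)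

variable {a b r : ℝ}

lemma intervalIntegrable_rpow_mul_exp_neg (ha : 0 < a) (c e : ℝ) :
    IntervalIntegrable (fun t => t ^ (a - 1) * exp (-t)) volume c e :=
  (intervalIntegral.intervalIntegrable_rpow' (by linarith)).mul_continuousOn (by fun_prop)

lemma continuous_lowerGamma (ha : 0 < a) : Continuous (lowerGamma a) :=
  intervalIntegral.continuous_primitive (intervalIntegrable_rpow_mul_exp_neg ha) 0

lemma hasDerivAt_lowerGamma (ha : 0 < a) (hr : 0 < r) :
    HasDerivAt (lowerGamma a) (r ^ (a - 1) * exp (-r)) r :=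
  intervalIntegral.integral_hasDerivAt_right (intervalIntegrable_rpow_mul_exp_neg ha 0 r)
    (Measurable.stronglyMeasurable (by fun_prop)).stronglyMeasurableAtFilter
    ((continuousAt_rpow_const r _ (.inl hr.ne')).mul (by fun_prop))

lemma lowerGamma_add_integral_Ioi (ha : 0 < a) (hr : 0 ≤ r) :
    lowerGamma a r + ∫ t in Ioi r, t ^ (a - 1) * exp (-t) = Gamma a := by
  have hint : IntegrableOn (fun t : ℝ => t ^ (a - 1) * exp (-t)) (Ioi 0) := by
    simpa using integrableOn_rpow_mul_exp_neg_mul ha one_pos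
  rw [lowerGamma, intervalIntegral.integral_interval_add_Ioi hint
    (hint.mono_set (Ioi_subset_Ioi hr))]
  simpa using integral_rpow_mul_exp_neg_mul_Ioi ha one_pos

lemma tendsto_lowerGamma (ha : 0 < a) : Tendsto (lowerGamma a) atTop (𝓝 (Gamma a)) := by
  have htotal := lowerGamma_add_integral_Ioi ha le_rfl
  rw [lowerGamma, intervalIntegral.integral_same, zero_add] at htotal
  rw [← htotal]
  refine intervalIntegral_tendsto_integral_Ioi 0 ?_ tendsto_id
  simpa using integrableOn_rpow_mul_exp_neg_mul ha one_pos

/-- The function whose nonpositivity on `(0, ∞)` is Alzer's inequality. -/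
def alzerGap (a b r : ℝ) : ℝ := Gamma a * (1 - exp (-(b * r))) ^ a - lowerGamma a r

/-- The ratio of the derivatives of the two terms of `alzerGap`, when `Γ(a + 1) b ^ a = 1`. -/
def alzerRatio (a b r : ℝ) : ℝ := expMean (b * r) ^ (a - 1) * exp ((1 - b) * r)

lemma alzerRatio_le_rpow {s : ℝ} (ha : 1 ≤ a) (hb : 0 < b) (hs : 0 < s) (hsr : s ≤ r) :
    alzerRatio a b s ≤ alzerRatio a b r ^ (s / r) := by
  have hr : 0 < r := hs.trans_le hsr
  have hpos := expMean_pos (mul_pos hb hr)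
  have hmean := expMean_mul_le_rpow (mul_pos hb hr) (div_pos hs hr) ((div_le_one hr).2 hsr)
  rw [show s / r * (b * r) = b * s by field_simp] at hmean
  rw [alzerRatio, alzerRatio, mul_rpow (by positivity) (exp_pos _).le, ← exp_mul,
    ← rpow_mul hpos.le, mul_comm (a - 1), rpow_mul hpos.le,
    show (1 - b) * r * (s / r) = (1 - b) * s by field_simp]
  have := (expMean_pos (mul_pos hb hs)).le
  gcongr

lemma alzerRatio_le_one_of_le {s : ℝ} (ha : 1 ≤ a) (hb : 0 < b) (hs : 0 < s) (hsr : s ≤ r)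
    (hle : alzerRatio a b r ≤ 1) : alzerRatio a b s ≤ 1 := by
  have hr : 0 < r := hs.trans_le hsr
  have hpos : 0 ≤ alzerRatio a b r := by
    have := expMean_pos (mul_pos hb hr)
    unfold alzerRatio
    positivity
  exact (alzerRatio_le_rpow ha hb hs hsr).trans (rpow_le_one hpos hle (by positivity))

lemma continuous_alzerGap (ha : 0 < a) : Continuous (alzerGap a b) :=
  (continuous_const.mul (Continuous.rpow_const (by fun_prop) fun _ => .inr ha.le)).sub
    (continuous_lowerGamma ha)

lemma alzerGap_zero (ha : a ≠ 0) : alzerGap a b 0 = 0 := by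
  simp [alzerGap, lowerGamma, zero_rpow ha]

lemma tendsto_alzerGap (ha : 0 < a) (hb : 0 < b) : Tendsto (alzerGap a b) atTop (𝓝 0) := by
  have hexp : Tendsto (fun r => exp (-(b * r))) atTop (𝓝 0) :=
    tendsto_exp_neg_atTop_nhds_zero.comp (tendsto_id.const_mul_atTop hb)
  have hlim := (((hexp.const_sub 1).rpow_const (p := a) (.inr ha.le)).const_mul (Gamma a)).sub
    (tendsto_lowerGamma ha)
  rwa [sub_zero, one_rpow, mul_one, sub_self] at hlim

lemma hasDerivAt_alzerGap (ha : 0 < a) (hb : 0 < b) (hab : Gamma (a + 1) * b ^ a = 1)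
    (hr : 0 < r) :
    HasDerivAt (alzerGap a b) (r ^ (a - 1) * exp (-r) * (alzerRatio a b r - 1)) r := by
  have hpos : 0 < 1 - exp (-(b * r)) := by simpa using mul_pos hb hr
  have hexp : HasDerivAt (fun r => 1 - exp (-(b * r))) (b * exp (-(b * r))) r := by
    simpa [mul_comm b] using ((hasDerivAt_id r).const_mul b).neg.exp.const_sub 1
  have hconst : Gamma a * a * b = (b ^ (a - 1))⁻¹ := by
    rw [Gamma_add_one ha.ne'] at hab
    rw [rpow_sub_one hb.ne']
    field_simp
    linarith
  have hratio : alzerRatio a b r * (r ^ (a - 1) * exp (-r)) =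
      (1 - exp (-(b * r))) ^ (a - 1) * (b ^ (a - 1))⁻¹ * exp (-(b * r)) := by
    rw [alzerRatio, expMean, div_rpow hpos.le (by positivity), mul_rpow hb.le hr.le,
      show -(b * r) = (1 - b) * r + -r by ring, exp_add]
    field_simp
  refine (((hexp.rpow_const (p := a) (.inl hpos.ne')).const_mul (Gamma a)).sub
    (hasDerivAt_lowerGamma ha hr)).congr_deriv ?_
  linear_combination (1 - exp (-(b * r))) ^ (a - 1) * exp (-(b * r)) * hconst - hratio

-- `{alzerRatio ≤ 1}` is an initial segment of `(0, ∞)`, so the gap first decreases from `0` and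
-- then increases to its limit `0`.
lemma alzerGap_nonpos (ha : 1 ≤ a) (hb : 0 < b) (hab : Gamma (a + 1) * b ^ a = 1) (hr : 0 < r) :
    alzerGap a b r ≤ 0 := by
  have ha0 : 0 < a := by linarith
  let gap' (s : ℝ) := s ^ (a - 1) * exp (-s) * (alzerRatio a b s - 1)
  have hderiv {s : ℝ} (hs : 0 < s) : HasDerivAt (alzerGap a b) (gap' s) s :=
    hasDerivAt_alzerGap ha0 hb hab hs
  by_cases hratio : alzerRatio a b r ≤ 1
  · have hanti : AntitoneOn (alzerGap a b) (Icc 0 r) := by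
      refine antitoneOn_of_hasDerivWithinAt_nonpos (f' := gap') (convex_Icc 0 r)
        (continuous_alzerGap ha0).continuousOn (fun s hs => ?_) fun s hs => ?_ <;>
        rw [interior_Icc] at hs
      · exact (hderiv hs.1).hasDerivWithinAt
      · have := hs.1
        exact mul_nonpos_of_nonneg_of_nonpos (by positivity)
          (sub_nonpos.2 (alzerRatio_le_one_of_le ha hb hs.1 hs.2.le hratio))
    rw [← alzerGap_zero (b := b) ha0.ne']
    exact hanti ⟨le_rfl, hr.le⟩ ⟨hr.le, le_rfl⟩ hr.le
  · have hmono : MonotoneOn (alzerGap a b) (Ici r) := by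
      refine monotoneOn_of_hasDerivWithinAt_nonneg (f' := gap') (convex_Ici r)
        (continuous_alzerGap ha0).continuousOn (fun s hs => ?_) fun s hs => ?_ <;>
        rw [interior_Ici] at hs
      · exact (hderiv (hr.trans hs)).hasDerivWithinAt
      · have : 0 < s := hr.trans hs
        have hs_ratio : 1 < alzerRatio a b s := by
          contrapose! hratio
          exact alzerRatio_le_one_of_le ha hb hr (le_of_lt hs) hratio
        exact mul_nonneg (by positivity) (by linarith)
    refine ge_of_tendsto (tendsto_alzerGap ha0 hb) ?_
    filter_upwards [eventually_ge_atTop r] with s hs using hmono self_mem_Ici hs hs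

theorem integral_Ioi_rpow_mul_exp_neg_le (ha : 1 ≤ a) (hr : 0 < r) :
    ∫ t in Ioi r, t ^ (a - 1) * exp (-t) ≤
      Gamma (a + 1) * exp (-((Gamma (a + 1) ^ (1 / a))⁻¹ * r)) := by
  have ha0 : 0 < a := by linarith
  have hGa := Gamma_pos_of_pos ha0
  have hGa1 := Gamma_pos_of_pos (show 0 < a + 1 by linarith)
  set b := (Gamma (a + 1) ^ (1 / a))⁻¹ with hb_def
  have hb : 0 < b := by positivity
  have hab : Gamma (a + 1) * b ^ a = 1 := by
    rw [hb_def, inv_rpow (by positivity), ← rpow_mul hGa1.le, one_div_mul_cancel ha0.ne', rpow_one,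
      mul_inv_cancel₀ hGa1.ne']
  have hgap := alzerGap_nonpos ha hb hab hr
  have htotal := lowerGamma_add_integral_Ioi ha0 hr.le
  have hbernoulli : 1 + a * -exp (-(b * r)) ≤ (1 - exp (-(b * r))) ^ a := by
    rw [sub_eq_add_neg]
    refine one_add_mul_self_le_rpow_one_add (neg_le_neg ?_) ha
    exact exp_le_one_iff.2 (neg_nonpos.2 (by positivity))
  have hGamma_bernoulli := mul_le_mul_of_nonneg_left hbernoulli hGa.le
  rw [alzerGap] at hgap
  rw [Gamma_add_one ha0.ne']
  linarith

end Alzer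

/-! ### Exponential decay of the covariance -/

section BesselBounds

variable {ν r : ℝ}

lemma exp_mul_sq_sub_one_rpow_nonneg (x p : ℝ) {t : ℝ} (ht : 1 < t) :
    0 ≤ exp x * (t ^ 2 - 1) ^ p := by
  have : 0 ≤ t ^ 2 - 1 := by nlinarith
  positivity

lemma besselK_nonneg (hν : -(1 / 2) < ν) (hr : 0 ≤ r) : 0 ≤ besselK ν r := by
  have := Gamma_pos_of_pos (show 0 < ν + 1 / 2 by linarith)
  have : 0 ≤ ∫ t in Ioi (1 : ℝ), exp (-(r * t)) * (t ^ 2 - 1) ^ (ν - 1 / 2) :=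
    setIntegral_nonneg measurableSet_Ioi fun t ht => exp_mul_sq_sub_one_rpow_nonneg _ _ ht
  unfold besselK
  positivity

lemma maternCorr_nonneg (hν : 0 < ν) (hr : 0 ≤ r) : 0 ≤ maternCorr ν r := by
  have := Gamma_pos_of_pos hν
  have := besselK_nonneg (show -(1 / 2) < ν by linarith) hr
  unfold maternCorr
  positivity

lemma integral_exp_mul_sq_sub_one_rpow_le_of_le_half (hν₀ : -(1 / 2) < ν) (hν : ν ≤ 1 / 2)
    (hr : 0 < r) :
    ∫ t in Ioi (1 : ℝ), exp (-(r * t)) * (t ^ 2 - 1) ^ (ν - 1 / 2) ≤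
      2 ^ (ν - 1 / 2) * exp (-r) * ((1 / r) ^ (ν + 1 / 2) * Gamma (ν + 1 / 2)) := by
  have hp : 0 < ν + 1 / 2 := by linarith
  have hshift := measurePreserving_sub_right (volume : Measure ℝ) 1
  have hemb := (MeasurableEquiv.subRight (1 : ℝ)).measurableEmbedding
  have hpre : (fun t : ℝ => t - 1) ⁻¹' Ioi 0 = Ioi 1 := by ext; simp
  have hint := (hshift.integrableOn_comp_preimage hemb).2
    (integrableOn_rpow_mul_exp_neg_mul hp hr)
  have hval := hshift.setIntegral_preimage_emb hemb
    (fun u => u ^ (ν + 1 / 2 - 1) * exp (-(r * u))) (Ioi 0)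
  rw [hpre] at hint hval
  rw [← integral_rpow_mul_exp_neg_mul_Ioi hp hr, ← hval, ← integral_const_mul]
  have hpt : ∀ t ∈ Ioi (1 : ℝ), exp (-(r * t)) * (t ^ 2 - 1) ^ (ν - 1 / 2) ≤
      2 ^ (ν - 1 / 2) * exp (-r) * ((t - 1) ^ (ν + 1 / 2 - 1) * exp (-(r * (t - 1)))) := by
    intro t (ht : 1 < t)
    have ht₁ : 0 < t - 1 := sub_pos.2 ht
    have : (t + 1) ^ (ν - 1 / 2) ≤ 2 ^ (ν - 1 / 2) :=
      rpow_le_rpow_of_nonpos two_pos (by linarith) (by linarith)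
    calc exp (-(r * t)) * (t ^ 2 - 1) ^ (ν - 1 / 2)
        = (t + 1) ^ (ν - 1 / 2) * exp (-r) *
          ((t - 1) ^ (ν + 1 / 2 - 1) * exp (-(r * (t - 1)))) := by
          rw [show t ^ 2 - 1 = (t + 1) * (t - 1) by ring, mul_rpow (by linarith) ht₁.le,
            show -(r * t) = -r + -(r * (t - 1)) by ring, exp_add,
            show ν + 1 / 2 - 1 = ν - 1 / 2 by ring]
          ring
      _ ≤ _ := by gcongr
  exact integral_mono_of_nonneg ((ae_restrict_mem measurableSet_Ioi).mono fun t ht =>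
    exp_mul_sq_sub_one_rpow_nonneg _ _ ht) (hint.const_mul _)
    ((ae_restrict_mem measurableSet_Ioi).mono hpt)

lemma maternCorr_le_of_le_half (hν₀ : 0 < ν) (hν : ν ≤ 1 / 2) (hr : 0 < r) :
    maternCorr ν r ≤ 2 ^ (1 / 2 - ν) * √π / Gamma ν * r ^ (ν - 1 / 2) * exp (-r) := by
  have := Gamma_pos_of_pos hν₀
  have := Gamma_pos_of_pos (show 0 < ν + 1 / 2 by linarith)
  have hJ := integral_exp_mul_sq_sub_one_rpow_le_of_le_half (by linarith) hν hr
  have htwo : (2 : ℝ) ^ (1 - ν) * (1 / 2) ^ ν * 2 ^ (ν - 1 / 2) = 2 ^ (1 / 2 - ν) := by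
    rw [one_div, inv_rpow zero_le_two, ← rpow_neg zero_le_two, ← rpow_add two_pos,
      ← rpow_add two_pos]
    ring_nf
  have hpow : r ^ ν * r ^ ν * (1 / r) ^ (ν + 1 / 2) = r ^ (ν - 1 / 2) := by
    rw [one_div, inv_rpow hr.le, ← rpow_neg hr.le, ← rpow_add hr, ← rpow_add hr]
    ring_nf
  unfold maternCorr besselK
  calc 2 ^ (1 - ν) / Gamma ν * r ^ ν * (√π / Gamma (ν + 1 / 2) * (r / 2) ^ ν * _)
      ≤ 2 ^ (1 - ν) / Gamma ν * r ^ ν * (√π / Gamma (ν + 1 / 2) * (r / 2) ^ ν *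
        (2 ^ (ν - 1 / 2) * exp (-r) * ((1 / r) ^ (ν + 1 / 2) * Gamma (ν + 1 / 2)))) := by
        gcongr
    _ = (2 ^ (1 - ν) * (1 / 2) ^ ν * 2 ^ (ν - 1 / 2)) * √π / Gamma ν *
        (r ^ ν * r ^ ν * (1 / r) ^ (ν + 1 / 2)) * exp (-r) := by
        rw [div_eq_mul_one_div r 2, mul_rpow hr.le (by positivity)]
        field_simp
    _ = _ := by rw [htwo, hpow]

lemma maternCorr_eq_integral_Ioi_one (hν : 0 < ν) (hr : 0 < r) :
    maternCorr ν r = r ^ (2 * ν) / Gamma (2 * ν) *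
      ∫ t in Ioi (1 : ℝ), exp (-(r * t)) * (t ^ 2 - 1) ^ (ν - 1 / 2) := by
  have := Gamma_pos_of_pos hν
  have hG' := Gamma_pos_of_pos (show 0 < ν + 1 / 2 by linarith)
  have := Gamma_pos_of_pos (show 0 < 2 * ν by linarith)
  have hdup := Gamma_mul_Gamma_add_half ν
  have htwo : (2 : ℝ) ^ (1 - ν) = 2 ^ (1 - 2 * ν) * 2 ^ ν := by
    rw [← rpow_add two_pos]; ring_nf
  unfold maternCorr besselK
  rw [div_rpow hr.le zero_le_two, two_mul ν, rpow_add hr, ← two_mul, htwo]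
  generalize Gamma (ν + 1 / 2) = G at *
  generalize ∫ t in Ioi (1 : ℝ), exp (-(r * t)) * (t ^ 2 - 1) ^ (ν - 1 / 2) = J
  field_simp
  linear_combination -J * hdup

lemma rpow_mul_integral_exp_mul_sq_sub_one_rpow_le (hν : 1 / 2 ≤ ν) (hr : 0 < r) :
    r ^ (2 * ν) * ∫ t in Ioi (1 : ℝ), exp (-(r * t)) * (t ^ 2 - 1) ^ (ν - 1 / 2) ≤
      ∫ t in Ioi r, t ^ (2 * ν - 1) * exp (-t) := by
  have hscale : ∫ t in Ioi r, t ^ (2 * ν - 1) * exp (-t) =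
      r ^ (2 * ν) * ∫ t in Ioi (1 : ℝ), t ^ (2 * ν - 1) * exp (-(r * t)) := by
    have h := integral_comp_mul_left_Ioi (fun t => t ^ (2 * ν - 1) * exp (-t)) 1 hr
    rw [mul_one, smul_eq_mul, eq_inv_mul_iff_mul_eq₀ hr.ne'] at h
    rw [← h, ← integral_const_mul, ← integral_const_mul]
    refine setIntegral_congr_fun measurableSet_Ioi fun t (ht : 1 < t) => ?_
    simp only [mul_rpow hr.le (zero_le_one.trans ht.le), rpow_sub_one hr.ne']
    field_simp
  rw [hscale]
  have hint := (integrableOn_rpow_mul_exp_neg_mul (show 0 < 2 * ν by linarith) hr).mono_set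
    (Ioi_subset_Ioi zero_le_one)
  refine mul_le_mul_of_nonneg_left (integral_mono_of_nonneg ?_ hint ?_) (rpow_nonneg hr.le _) <;>
    filter_upwards [ae_restrict_mem measurableSet_Ioi] with t (ht : 1 < t)
  · exact exp_mul_sq_sub_one_rpow_nonneg _ _ ht
  · have : (t ^ 2 - 1) ^ (ν - 1 / 2) ≤ t ^ (2 * ν - 1) := by
      rw [show 2 * ν - 1 = 2 * (ν - 1 / 2) by ring, rpow_mul (by linarith), rpow_two]
      exact rpow_le_rpow (by nlinarith) (by linarith) (by linarith)
    rw [mul_comm]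
    gcongr

lemma maternCorr_le_of_half_le (hν : 1 / 2 ≤ ν) (hr : 0 < r) :
    maternCorr ν r ≤ 2 * ν * exp (-((Gamma (1 + 2 * ν) ^ (1 / (2 * ν)))⁻¹ * r)) := by
  have hν₀ : 0 < ν := by linarith
  have hG := Gamma_pos_of_pos (show 0 < 2 * ν by linarith)
  have htail := (rpow_mul_integral_exp_mul_sq_sub_one_rpow_le hν hr).trans
    (integral_Ioi_rpow_mul_exp_neg_le (by linarith) hr)
  rw [maternCorr_eq_integral_Ioi_one hν₀ hr, div_mul_eq_mul_div, div_le_iff₀ hG, add_comm 1]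
  refine htail.trans_eq ?_
  rw [Gamma_add_one (by positivity)]
  ring

end BesselBounds

lemma sum_abs_le_sqrt_card_mul_norm {ι : Type*} [Fintype ι] (x : EuclideanSpace ℝ ι) :
    ∑ i, |x i| ≤ √(Fintype.card ι) * ‖x‖ := by
  rw [EuclideanSpace.norm_eq, ← sqrt_mul (Nat.cast_nonneg _)]
  refine le_sqrt_of_sq_le ?_
  simpa using sq_sum_le_card_mul_sum_sq (s := Finset.univ) (f := fun i => |x i|)

section CovarianceDecay

variable {d : ℕ} {ρ ν α : ℝ}

lemma beta_pos (hd : 1 ≤ d) (hα : 0 < α) : 0 < beta d ν α := by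
  have : 0 < max (Gamma (1 + 2 * ν) ^ (1 / (2 * ν))) 1 := lt_max_of_lt_right one_pos
  unfold beta
  positivity

lemma exp_neg_inv_mul_norm_div_le (hd : 1 ≤ d) (hα : 0 < α) {M : ℝ} (hM : 0 < M)
    (hMβ : M ≤ max (Gamma (1 + 2 * ν) ^ (1 / (2 * ν))) 1) (x : EuclideanSpace ℝ (Fin d)) :
    exp (-(M⁻¹ * (‖x‖ / α))) ≤ exp (-(beta d ν α * ∑ i, |x i|)) := by
  have hβ := (beta_pos hd hα (ν := ν)).le
  have hsum : ∑ i, |x i| ≤ √d * ‖x‖ := by simpa using sum_abs_le_sqrt_card_mul_norm x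
  rw [exp_le_exp, neg_le_neg_iff]
  calc beta d ν α * ∑ i, |x i|
      ≤ beta d ν α * (√d * ‖x‖) := by gcongr
    _ = (max (Gamma (1 + 2 * ν) ^ (1 / (2 * ν))) 1)⁻¹ * (‖x‖ / α) := by
        unfold beta
        field_simp
    _ ≤ M⁻¹ * (‖x‖ / α) := by gcongr

lemma errorConst_nonneg (d : ℕ) (ρ ν : ℝ) (hα : 0 ≤ α) : 0 ≤ errorConst d ρ ν α := by
  unfold errorConst
  split_ifs <;> positivity

lemma sqrt_errorConst_div_of_le_half (hd : d ≠ 0) (hν₀ : 0 < ν) (hν : ν ≤ 1 / 2) (hα : 0 < α) :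
    √(errorConst d ρ ν α / d) = |ρ| * ((4 * α) ^ (1 / 2 - ν) * √π / Gamma ν) := by
  have := Gamma_pos_of_pos hν₀
  rw [← sqrt_sq (show 0 ≤ |ρ| * ((4 * α) ^ (1 / 2 - ν) * √π / Gamma ν) by positivity), errorConst,
    if_pos hν, mul_pow, div_pow, mul_pow, sq_abs, sq_sqrt pi_pos.le,
    ← rpow_mul_natCast (by positivity), show (1 / 2 - ν) * (2 : ℕ) = 1 - 2 * ν by push_cast; ring]
  field_simp

lemma sqrt_errorConst_div_of_half_lt (hd : d ≠ 0) (hν : 1 / 2 < ν) :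
    √(errorConst d ρ ν α / d) = |ρ| * (2 * ν) := by
  have : 0 < ν := by linarith
  rw [← sqrt_sq (show 0 ≤ |ρ| * (2 * ν) by positivity), errorConst, if_neg hν.not_ge, mul_pow,
    sq_abs]
  congr 1
  field_simp
  ring

lemma abs_cov_of_ne_zero (hν : 0 < ν) (hα : 0 < α) {x : EuclideanSpace ℝ (Fin d)} (hx : x ≠ 0) :
    |cov d ρ ν α x| = |ρ| * maternCorr ν (‖x‖ / α) := by
  rw [cov_of_ne_zero hα hx, abs_mul, abs_of_nonneg (maternCorr_nonneg hν (by positivity))]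

theorem abs_cov_le (hd : 1 ≤ d) (hν : 0 < ν) (hα : 0 < α) {x : EuclideanSpace ℝ (Fin d)}
    (hx : 1 / 2 ≤ ‖x‖) :
    |cov d ρ ν α x| ≤ √(errorConst d ρ ν α / d) * exp (-(beta d ν α * ∑ i, |x i|)) := by
  have hx₀ : x ≠ 0 := norm_pos_iff.1 (by linarith)
  have hr : 0 < ‖x‖ / α := div_pos (norm_pos_iff.2 hx₀) hα
  rw [abs_cov_of_ne_zero hν hα hx₀]
  rcases le_or_gt ν (1 / 2) with hν' | hν'
  · rw [sqrt_errorConst_div_of_le_half (by omega) hν hν' hα, mul_assoc |ρ|]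
    refine mul_le_mul_of_nonneg_left ?_ (abs_nonneg ρ)
    have := Gamma_pos_of_pos hν
    have hexp : exp (-(‖x‖ / α)) ≤ exp (-(beta d ν α * ∑ i, |x i|)) := by
      simpa using exp_neg_inv_mul_norm_div_le hd hα one_pos (le_max_right _ _) x
    have hpow : (‖x‖ / α) ^ (ν - 1 / 2) ≤ (2 * α) ^ (1 / 2 - ν) := by
      rw [← neg_sub ν, rpow_neg (by positivity), ← inv_rpow (by positivity)]
      refine rpow_le_rpow_of_nonpos (by positivity) ?_ (by linarith)
      rw [le_div_iff₀ hα]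
      field_simp
      linarith
    calc maternCorr ν (‖x‖ / α)
        ≤ 2 ^ (1 / 2 - ν) * √π / Gamma ν * (‖x‖ / α) ^ (ν - 1 / 2) * exp (-(‖x‖ / α)) :=
          maternCorr_le_of_le_half hν hν' hr
      _ ≤ 2 ^ (1 / 2 - ν) * √π / Gamma ν * (2 * α) ^ (1 / 2 - ν) *
          exp (-(beta d ν α * ∑ i, |x i|)) := by gcongr
      _ = _ := by
          have hfour : (4 * α) ^ (1 / 2 - ν) = 2 ^ (1 / 2 - ν) * (2 * α) ^ (1 / 2 - ν) := by
            rw [← mul_rpow zero_le_two (by positivity)]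
            ring_nf
          rw [hfour]
          ring
  · rw [sqrt_errorConst_div_of_half_lt (by omega) hν', mul_assoc |ρ|]
    refine mul_le_mul_of_nonneg_left ?_ (abs_nonneg ρ)
    have := Gamma_pos_of_pos (show 0 < 1 + 2 * ν by linarith)
    exact (maternCorr_le_of_half_le hν'.le hr).trans (mul_le_mul_of_nonneg_left
      (exp_neg_inv_mul_norm_div_le hd hα (by positivity) (le_max_left _ _) x) (by positivity))

end CovarianceDecay

/-! ### Aliasing error of an exponentially decaying function -/

section Aliasing

variable {b : ℝ}

/-- The nearest term `e^{-b|x|}` of the periodized exponential `∑ₙ e^{-b|x+n|}`. -/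
def nearExp (b x : ℝ) : ℝ := exp (-(b * |x|))

/-- The remaining terms `∑_{n ≠ 0} e^{-b|x+n|}` of the periodized exponential, in closed form;
the formula is the sum of the series for `|x| ≤ 1/2` only. -/
def tailExp (b x : ℝ) : ℝ := exp (-b) / (1 - exp (-b)) * (exp (-(b * |x|)) + exp (b * |x|))

lemma nearExp_pos (b x : ℝ) : 0 < nearExp b x := exp_pos _

lemma one_sub_exp_neg_pos (hb : 0 < b) : 0 < 1 - exp (-b) := by simpa using hb

lemma tailExp_nonneg (hb : 0 < b) (x : ℝ) : 0 ≤ tailExp b x := by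
  have := one_sub_exp_neg_pos hb
  unfold tailExp
  positivity

@[fun_prop]
lemma continuous_nearExp (b : ℝ) : Continuous (nearExp b) := by unfold nearExp; fun_prop

@[fun_prop]
lemma continuous_tailExp (b : ℝ) : Continuous (tailExp b) := by unfold tailExp; fun_prop

lemma hasSum_exp_neg_mul_add_one_add (hb : 0 < b) (x : ℝ) :
    HasSum (fun n : ℕ => exp (-(b * (n + 1 + x))))
      (exp (-b) / (1 - exp (-b)) * exp (-(b * x))) := by
  have hgeom := (hasSum_geometric_of_lt_one (exp_pos (-b)).le (by simpa using hb)).mul_left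
    (exp (-b) * exp (-(b * x)))
  rw [show exp (-b) / (1 - exp (-b)) * exp (-(b * x)) =
    exp (-b) * exp (-(b * x)) * (1 - exp (-b))⁻¹ by ring]
  refine hgeom.congr_fun fun n => ?_
  rw [← exp_nat_mul, ← exp_add, ← exp_add]
  ring_nf

lemma hasSum_nearExp_add_intCast (hb : 0 < b) {x : ℝ} (hx : |x| ≤ 1 / 2) :
    HasSum (fun n : ℤ => nearExp b (x + n)) (nearExp b x + tailExp b x) := by
  obtain ⟨hx₁, hx₂⟩ := abs_le.1 hx
  have hpos : HasSum (fun n : ℕ => nearExp b (x + (n + 1 : ℤ)))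
      (exp (-b) / (1 - exp (-b)) * exp (-(b * x))) := by
    refine (hasSum_exp_neg_mul_add_one_add hb x).congr_fun fun n => ?_
    push_cast [nearExp]
    rw [abs_of_nonneg (by linarith [n.cast_nonneg (α := ℝ)]), add_comm x]
  have hneg : HasSum (fun n : ℕ => nearExp b (x + (-(n + 1 : ℤ) : ℤ)))
      (exp (-b) / (1 - exp (-b)) * exp (-(b * -x))) := by
    refine (hasSum_exp_neg_mul_add_one_add hb (-x)).congr_fun fun n => ?_
    push_cast [nearExp]
    rw [abs_of_nonpos (by linarith [n.cast_nonneg (α := ℝ)])]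
    ring_nf
  have hsymm : exp (-(b * x)) + exp (-(b * -x)) = exp (-(b * |x|)) + exp (b * |x|) := by
    rcases abs_choice x with h | h <;> rw [h]
    · simp only [mul_neg, neg_neg]
    · simp only [mul_neg, neg_neg, add_comm]
  have h := HasSum.of_add_one_of_neg_add_one (f := fun n : ℤ => nearExp b (x + n)) hpos hneg
  convert! h using 1
  rw [tailExp, ← hsymm, Int.cast_zero, add_zero]
  ring

variable {d : ℕ} {x : EuclideanSpace ℝ (Fin d)}

/-- The sum of `e^{-b‖x+n‖₁}` over the nonzero lattice points `n`, for `x` in the unit cube: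
the periodization of `e^{-b‖x‖₁}` minus its nearest term. -/
def aliasingSum (b : ℝ) (x : EuclideanSpace ℝ (Fin d)) : ℝ :=
  ∏ i, (nearExp b (x i) + tailExp b (x i)) - ∏ i, nearExp b (x i)

lemma abs_le_half_of_mem_unitCube (hx : x ∈ unitCube d) (i : Fin d) : |x i| ≤ 1 / 2 :=
  abs_le.2 (hx i)

@[simp]
lemma latticePoint_zero : latticePoint (0 : Fin d → ℤ) = 0 := by ext i; simp [latticePoint]

lemma add_latticePoint_apply (x : EuclideanSpace ℝ (Fin d)) (n : Fin d → ℤ) (i : Fin d) :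
    (x + latticePoint n) i = x i + n i := by
  simp [latticePoint]

lemma exp_neg_mul_sum_abs (b : ℝ) (x : EuclideanSpace ℝ (Fin d)) :
    exp (-(b * ∑ i, |x i|)) = ∏ i, nearExp b (x i) := by
  simp only [nearExp, ← exp_sum, Finset.mul_sum, Finset.sum_neg_distrib]

lemma half_le_norm_add_latticePoint (hx : x ∈ unitCube d) {n : Fin d → ℤ} (hn : n ≠ 0) :
    1 / 2 ≤ ‖x + latticePoint n‖ := by
  obtain ⟨i, hi⟩ := Function.ne_iff.1 hn
  have hone : (1 : ℝ) ≤ |(n i : ℝ)| := by exact_mod_cast Int.one_le_abs hi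
  have hxi := abs_le_half_of_mem_unitCube hx i
  calc (1 / 2 : ℝ) ≤ |(n i : ℝ)| - |x i| := by linarith
    _ ≤ |x i + n i| := by
        simpa [add_comm] using abs_sub_abs_le_abs_sub (n i : ℝ) (-x i)
    _ ≤ ‖x + latticePoint n‖ := by
        rw [← add_latticePoint_apply]
        exact PiLp.norm_apply_le (x + latticePoint n) i

lemma hasSum_exp_neg_mul_sum_abs (hb : 0 < b) (hx : x ∈ unitCube d) :
    HasSum (fun n : Fin d → ℤ => exp (-(b * ∑ i, |(x + latticePoint n) i|)))
      (∏ i, (nearExp b (x i) + tailExp b (x i))) := by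
  have hcoord (i : Fin d) := hasSum_nearExp_add_intCast hb (abs_le_half_of_mem_unitCube hx i)
  have h := hasSum_prod_fin fun i => (hcoord i).summable.norm
  simp only [fun i => (hcoord i).tsum_eq] at h
  exact h.congr_fun fun n => by
    rw [exp_neg_mul_sum_abs]
    simp only [add_latticePoint_apply]

lemma hasSum_ite_exp_neg_mul_sum_abs (hb : 0 < b) (hx : x ∈ unitCube d) :
    HasSum (fun n : Fin d → ℤ => if n = 0 then 0 else exp (-(b * ∑ i, |(x + latticePoint n) i|)))
      (aliasingSum b x) := by
  classical
  simpa [aliasingSum, exp_neg_mul_sum_abs] using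
    hasSum_ite_sub_hasSum (hasSum_exp_neg_mul_sum_abs hb hx) 0

variable {E : Type*} [NormedAddCommGroup E] [CompleteSpace E] {f : EuclideanSpace ℝ (Fin d) → E}
  {C : ℝ}

lemma summable_add_latticePoint (hb : 0 < b)
    (hf : ∀ y, 1 / 2 ≤ ‖y‖ → ‖f y‖ ≤ C * exp (-(b * ∑ i, |y i|))) (hx : x ∈ unitCube d) :
    Summable fun n => f (x + latticePoint n) := by
  refine ((hasSum_exp_neg_mul_sum_abs hb hx).summable.mul_left C).of_norm_bounded_eventually ?_
  filter_upwards [(Set.finite_singleton (0 : Fin d → ℤ)).compl_mem_cofinite] with n hn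
  exact hf _ (half_le_norm_add_latticePoint hx hn)

lemma norm_sub_tsum_add_latticePoint_le (hb : 0 < b)
    (hf : ∀ y, 1 / 2 ≤ ‖y‖ → ‖f y‖ ≤ C * exp (-(b * ∑ i, |y i|))) (hx : x ∈ unitCube d) :
    ‖f x - ∑' n, f (x + latticePoint n)‖ ≤ C * aliasingSum b x := by
  classical
  rw [(summable_add_latticePoint hb hf hx).tsum_eq_add_tsum_ite 0, latticePoint_zero, add_zero,
    sub_add_cancel_left, norm_neg]
  refine tsum_of_norm_bounded ((hasSum_ite_exp_neg_mul_sum_abs hb hx).mul_left C) fun n => ?_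
  split_ifs with hn
  · simp
  · exact hf _ (half_le_norm_add_latticePoint hx hn)

end Aliasing

theorem norm_cov_sub_covApp_le {d : ℕ} {ρ ν α : ℝ} (hd : 1 ≤ d) (hν : 0 < ν) (hα : 0 < α)
    {x : EuclideanSpace ℝ (Fin d)} (hx : x ∈ unitCube d) :
    ‖(cov d ρ ν α x : ℂ) - covApp d ρ ν α x‖ ≤
      √(errorConst d ρ ν α / d) * aliasingSum (beta d ν α) x := by
  have hβ := beta_pos hd hα (ν := ν)
  have hdecay (y : EuclideanSpace ℝ (Fin d)) (hy : 1 / 2 ≤ ‖y‖) :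
      ‖cov d ρ ν α y‖ ≤ √(errorConst d ρ ν α / d) * exp (-(beta d ν α * ∑ i, |y i|)) :=
    abs_cov_le hd hν hα hy
  rw [covApp_eq_tsum hν hα x (summable_add_latticePoint hβ hdecay hx), ← Complex.ofReal_sub,
    Complex.norm_real]
  exact norm_sub_tsum_add_latticePoint_le hβ hdecay hx

/-! ### Mean square of the aliasing sum over the unit cube -/

section UnitInterval

lemma integral_Icc_neg_comp_abs (f : ℝ → ℝ) (a : ℝ) :
    ∫ x in Icc (-a) a, f |x| = 2 * ∫ x in Ioc 0 a, f x := by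
  have h := integral_comp_abs (f := (Iic a).indicator f)
  rw [setIntegral_indicator measurableSet_Iic, Ioi_inter_Iic] at h
  rw [← h, ← integral_indicator measurableSet_Icc]
  congr with x
  simp only [indicator, mem_Icc, mem_Iic, abs_le]

lemma integral_Ioc_half_exp_sq {c : ℝ} (hc : c ≠ 0) :
    ∫ x in Ioc (0 : ℝ) (1 / 2), exp (c * x) ^ 2 = (exp c - 1) / (2 * c) := by
  have h := intervalIntegral.integral_comp_mul_left (a := 0) (b := 1 / 2) exp
    (mul_ne_zero two_ne_zero hc)
  rw [intervalIntegral.integral_of_le (by norm_num), integral_exp] at h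
  rw [smul_eq_mul, mul_zero, exp_zero, mul_one_div, mul_div_cancel_left₀ c two_ne_zero,
    inv_mul_eq_div] at h
  simpa only [← exp_nat_mul, Nat.cast_ofNat, mul_assoc] using h

variable {b : ℝ}

lemma integral_exp_abs_mul_exp_abs (hb : b ≠ 0) (s t s' t' : ℝ) :
    ∫ x in Icc (-(1 / 2) : ℝ) (1 / 2), (s * exp (-(b * |x|)) + t * exp (b * |x|)) *
        (s' * exp (-(b * |x|)) + t' * exp (b * |x|)) =
      s * s' * ((1 - exp (-b)) / b) + (s * t' + s' * t) + t * t' * (((exp (-b))⁻¹ - 1) / b) := by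
  have hexpand (x : ℝ) : (s * exp (-(b * x)) + t * exp (b * x)) *
      (s' * exp (-(b * x)) + t' * exp (b * x)) =
      s * s' * exp (-b * x) ^ 2 + (s * t' + s' * t) + t * t' * exp (b * x) ^ 2 := by
    have hinv : exp (b * x) * exp (-(b * x)) = 1 := by rw [← exp_add, add_neg_cancel, exp_zero]
    rw [neg_mul]
    linear_combination (s * t' + s' * t) * hinv
  rw [integral_Icc_neg_comp_abs fun x => (s * exp (-(b * x)) + t * exp (b * x)) *
    (s' * exp (-(b * x)) + t' * exp (b * x))]
  simp only [hexpand]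
  rw [integral_add (Continuous.integrableOn_Ioc (by fun_prop))
      (Continuous.integrableOn_Ioc (by fun_prop)),
    integral_add (Continuous.integrableOn_Ioc (by fun_prop))
      (Continuous.integrableOn_Ioc (by fun_prop)), integral_const_mul, integral_const_mul,
    integral_Ioc_half_exp_sq hb, integral_Ioc_half_exp_sq (neg_ne_zero.2 hb), setIntegral_const,
    exp_neg b, inv_inv]
  simp only [mul_neg, one_div, volume_real_Ioc, sub_zero, inv_nonneg, Nat.ofNat_nonneg,
    sup_of_le_left, smul_eq_mul]
  field_simp
  ring

/-- `∫ S(x)² dx` over `[-1/2, 1/2]`, where `S(x) = ∑ₙ e^{-b|x+n|}`. -/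
def sqMass (b : ℝ) : ℝ :=
  1 / b + 2 * exp (-b) / (1 - exp (-b)) * (1 / b + 1 / (1 - exp (-b)))

/-- `∫ e^{-b|x|} S(x) dx` over `[-1/2, 1/2]`, where `S(x) = ∑ₙ e^{-b|x+n|}`. -/
def crossMass (b : ℝ) : ℝ := 1 / b + exp (-b) / (1 - exp (-b))

lemma nearExp_add_tailExp (b x : ℝ) : nearExp b x + tailExp b x =
    (1 + exp (-b) / (1 - exp (-b))) * exp (-(b * |x|)) +
      exp (-b) / (1 - exp (-b)) * exp (b * |x|) := by
  unfold nearExp tailExp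
  ring

lemma integral_sq_nearExp_add_tailExp (hb : 0 < b) :
    ∫ x in Icc (-(1 / 2) : ℝ) (1 / 2), (nearExp b x + tailExp b x) ^ 2 = sqMass b := by
  have hq := one_sub_exp_neg_pos hb
  simp only [sq, nearExp_add_tailExp, integral_exp_abs_mul_exp_abs hb.ne', sqMass]
  field_simp
  ring

lemma integral_nearExp_mul_nearExp_add_tailExp (hb : 0 < b) :
    ∫ x in Icc (-(1 / 2) : ℝ) (1 / 2), nearExp b x * (nearExp b x + tailExp b x) =
      crossMass b := by
  have hq := one_sub_exp_neg_pos hb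
  have h := integral_exp_abs_mul_exp_abs hb.ne' 1 0 (1 + exp (-b) / (1 - exp (-b)))
    (exp (-b) / (1 - exp (-b)))
  simp only [one_mul, zero_mul, add_zero, mul_zero, ← nearExp_add_tailExp] at h
  rw [crossMass]
  refine h.trans ?_
  field_simp
  ring

lemma integral_sq_tailExp (hb : 0 < b) :
    ∫ x in Icc (-(1 / 2) : ℝ) (1 / 2), tailExp b x ^ 2 = epsOne b := by
  have hq := one_sub_exp_neg_pos hb
  have htail (x : ℝ) : tailExp b x = exp (-b) / (1 - exp (-b)) * exp (-(b * |x|)) +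
      exp (-b) / (1 - exp (-b)) * exp (b * |x|) := mul_add _ _ _
  simp only [sq, htail, integral_exp_abs_mul_exp_abs hb.ne', epsOne]
  field_simp
  ring

end UnitInterval

section MassInequality

variable {b : ℝ}

/-- The first factor of `epsMulti`; the second one is `sqMass b ^ (d - 1)`. -/
def epsHead (b : ℝ) : ℝ := exp (-b) * (1 / b + 2 / (1 - exp (-b)) ^ 2 - 1 / 2)

/-- `coth (b / 2)`. -/
def cothHalf (b : ℝ) : ℝ := (1 + exp (-b)) / (1 - exp (-b))

lemma one_lt_cothHalf (hb : 0 < b) : 1 < cothHalf b := by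
  rw [cothHalf, one_lt_div (one_sub_exp_neg_pos hb)]
  linarith [exp_pos (-b)]

lemma one_div_le_cothHalf_div_two (hb : 0 < b) : 1 / b ≤ cothHalf b / 2 := by
  have h := le_log_one_add_of_nonneg (sub_nonneg.2 (one_le_exp hb.le))
  rw [add_sub_cancel, log_exp, div_le_iff₀ (by linarith [exp_pos b])] at h
  have hq := one_sub_exp_neg_pos hb
  rw [cothHalf, div_div, div_le_div_iff₀ hb (by positivity)]
  have hinv : exp b * exp (-b) = 1 := by rw [← exp_add, add_neg_cancel, exp_zero]
  linear_combination exp (-b) * h + (b - 2) * hinv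

lemma sqMass_eq (hb : 0 < b) :
    sqMass b = cothHalf b * (1 / b) + (cothHalf b ^ 2 - 1) / 2 := by
  have hq := one_sub_exp_neg_pos hb
  unfold sqMass cothHalf
  field_simp
  ring

lemma crossMass_eq (hb : 0 < b) : crossMass b = 1 / b + (cothHalf b - 1) / 2 := by
  have hq := one_sub_exp_neg_pos hb
  unfold crossMass cothHalf
  field_simp
  ring

lemma epsHead_eq (hb : 0 < b) :
    epsHead b = exp (-b) * (1 / b - 1 / 2) + (cothHalf b ^ 2 - 1) / 2 := by
  have hq := one_sub_exp_neg_pos hb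
  unfold epsHead cothHalf
  field_simp
  ring

lemma sqMass_sub_crossMass_eq (hb : 0 < b) :
    sqMass b - crossMass b = epsHead b - exp (-b) * cothHalf b * (1 / 2 - 1 / b) := by
  have hq := one_sub_exp_neg_pos hb
  unfold sqMass crossMass epsHead cothHalf
  field_simp
  ring

lemma crossMass_pos (hb : 0 < b) : 0 < crossMass b := by
  have := one_sub_exp_neg_pos hb
  unfold crossMass
  positivity

lemma crossMass_le_sqMass (hb : 0 < b) : crossMass b ≤ sqMass b := by
  have hc := one_lt_cothHalf hb
  have hp : 0 < 1 / b := by positivity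
  rw [crossMass_eq hb, sqMass_eq hb]
  nlinarith

lemma sqMass_sq_sub_crossMass_sq_le (hb : 0 < b) :
    sqMass b ^ 2 - crossMass b ^ 2 ≤ 2 * epsHead b * sqMass b := by
  have hc := one_lt_cothHalf hb
  have hB := (crossMass_pos hb).trans_le (crossMass_le_sqMass hb)
  rcases le_total (1 / b) (1 / 2) with hp | hp
  · have hrem : 0 ≤ exp (-b) * cothHalf b * (1 / 2 - 1 / b) := by
      have := sub_nonneg.2 hp
      positivity
    have hdiff := sqMass_sub_crossMass_eq hb
    calc sqMass b ^ 2 - crossMass b ^ 2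
        = 2 * (sqMass b - crossMass b) * sqMass b - (sqMass b - crossMass b) ^ 2 := by ring
      _ ≤ 2 * (sqMass b - crossMass b) * sqMass b := sub_le_self _ (sq_nonneg _)
      _ ≤ 2 * epsHead b * sqMass b := by gcongr; linarith
  · have hpc := one_div_le_cothHalf_div_two hb
    have hhead : (cothHalf b ^ 2 - 1) / 2 ≤ epsHead b := by
      rw [epsHead_eq hb, le_add_iff_nonneg_left]
      exact mul_nonneg (exp_pos _).le (sub_nonneg.2 hp)
    refine le_trans ?_ (mul_le_mul_of_nonneg_right
      (mul_le_mul_of_nonneg_left hhead zero_le_two) hB.le)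
    rw [sqMass_eq hb, crossMass_eq hb]
    generalize cothHalf b = c, 1 / b = p at *
    have hgap : 0 ≤ (c / 2 - p) * ((c + 1) * (c / 2 + p) - 1) :=
      mul_nonneg (by linarith) (by nlinarith)
    have hrem : 0 ≤ (c - 1) * ((c - 1) / 2 + (c / 2 - p) * ((c + 1) * (c / 2 + p) - 1)) :=
      mul_nonneg (by linarith) (by linarith)
    linear_combination hrem

lemma pow_sub_pow_le_mul_pow {A B E : ℝ} (hE : 0 ≤ E) (hEB : E ≤ B)
    (h : B ^ 2 - E ^ 2 ≤ 2 * A * B) (n : ℕ) :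
    B ^ (n + 2) - E ^ (n + 2) ≤ (n + 2) * (A * B ^ (n + 1)) := by
  have hB : 0 ≤ B := hE.trans hEB
  induction n with
  | zero => linear_combination h
  | succ n ih =>
    have hstep : E * (B - E) ≤ A * B := by
      linear_combination (1 / 2) * h + (1 / 2) * sq_nonneg (B - E)
    push_cast
    calc B ^ (n + 1 + 2) - E ^ (n + 1 + 2)
        = B * (B ^ (n + 2) - E ^ (n + 2)) + E ^ (n + 1) * (E * (B - E)) := by ring
      _ ≤ B * ((n + 2) * (A * B ^ (n + 1))) + B ^ (n + 1) * (E * (B - E)) := by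
          have : 0 ≤ E * (B - E) := mul_nonneg hE (sub_nonneg.2 hEB)
          gcongr
      _ ≤ B * ((n + 2) * (A * B ^ (n + 1))) + B ^ (n + 1) * (A * B) := by gcongr
      _ = (n + 1 + 2) * (A * B ^ (n + 1 + 1)) := by ring

end MassInequality

section UnitCube

variable {d : ℕ}

lemma unitCube_eq_preimage (d : ℕ) : unitCube d =
    PiLp.homeomorph 2 (fun _ : Fin d => ℝ) ⁻¹' univ.pi fun _ => Icc (-(1 / 2)) (1 / 2) := by
  ext x
  exact mem_univ_pi.symm

lemma isCompact_unitCube (d : ℕ) : IsCompact (unitCube d) := by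
  rw [unitCube_eq_preimage, Homeomorph.isCompact_preimage]
  exact isCompact_univ_pi fun _ => isCompact_Icc

lemma integral_unitCube_prod (f : ℝ → ℝ) :
    ∫ x in unitCube d, ∏ i, f (x i) = (∫ t in Icc (-(1 / 2)) (1 / 2), f t) ^ d := by
  rw [unitCube_eq_preimage]
  refine ((PiLp.volume_preserving_ofLp (Fin d)).setIntegral_preimage_emb
    (MeasurableEquiv.toLp 2 (Fin d → ℝ)).symm.measurableEmbedding
    (fun y => ∏ i, f (y i)) _).trans ?_
  rw [volume_pi, Measure.restrict_pi_pi, integral_fintype_prod_eq_pow, Fintype.card_fin]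

variable {b : ℝ}

@[fun_prop]
lemma continuous_aliasingSum (b : ℝ) :
    Continuous (aliasingSum b : EuclideanSpace ℝ (Fin d) → ℝ) := by
  unfold aliasingSum
  fun_prop

lemma integrableOn_aliasingSum_sq (d : ℕ) (b : ℝ) :
    IntegrableOn (fun x => aliasingSum b x ^ 2) (unitCube d) :=
  (Continuous.continuousOn (by fun_prop)).integrableOn_compact (isCompact_unitCube d)

lemma aliasingSum_sq_le (hb : 0 < b) (x : EuclideanSpace ℝ (Fin d)) :
    aliasingSum b x ^ 2 ≤ ∏ i, (nearExp b (x i) + tailExp b (x i)) ^ 2 -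
      ∏ i, nearExp b (x i) * (nearExp b (x i) + tailExp b (x i)) := by
  have hnonneg : 0 ≤ ∏ i, nearExp b (x i) := Finset.prod_nonneg fun i _ => (nearExp_pos _ _).le
  have hle : ∏ i, nearExp b (x i) ≤ ∏ i, (nearExp b (x i) + tailExp b (x i)) :=
    Finset.prod_le_prod (fun i _ => (nearExp_pos _ _).le)
      fun i _ => le_add_of_nonneg_right (tailExp_nonneg hb _)
  rw [aliasingSum, Finset.prod_pow, Finset.prod_mul_distrib]
  nlinarith

lemma integral_aliasingSum_sq_le_sqMass_pow_sub (hb : 0 < b) :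
    ∫ x in unitCube d, aliasingSum b x ^ 2 ≤ sqMass b ^ d - crossMass b ^ d := by
  have hint {f : EuclideanSpace ℝ (Fin d) → ℝ} (hf : Continuous f) : IntegrableOn f (unitCube d) :=
    hf.continuousOn.integrableOn_compact (isCompact_unitCube d)
  refine (setIntegral_mono_on (integrableOn_aliasingSum_sq d b) ((hint (by fun_prop)).sub
    (hint (by fun_prop))) (isCompact_unitCube d).measurableSet
    fun x _ => aliasingSum_sq_le hb x).trans_eq ?_
  simp only [Pi.sub_apply]
  rw [integral_sub (hint (by fun_prop)) (hint (by fun_prop)),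
    integral_unitCube_prod fun t => (nearExp b t + tailExp b t) ^ 2,
    integral_unitCube_prod fun t => nearExp b t * (nearExp b t + tailExp b t),
    integral_sq_nearExp_add_tailExp hb, integral_nearExp_mul_nearExp_add_tailExp hb]

lemma integral_aliasingSum_sq_one (hb : 0 < b) :
    ∫ x in unitCube 1, aliasingSum b x ^ 2 = epsOne b := by
  rw [← integral_sq_tailExp hb, ← pow_one (∫ t in Icc (-(1 / 2) : ℝ) (1 / 2), tailExp b t ^ 2),
    ← integral_unitCube_prod]
  simp [aliasingSum]

theorem integral_aliasingSum_sq_le (hd : 1 ≤ d) (hb : 0 < b) :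
    ∫ x in unitCube d, aliasingSum b x ^ 2 ≤ d * if d = 1 then epsOne b else epsMulti d b := by
  rcases hd.eq_or_lt with rfl | hd
  · simp [integral_aliasingSum_sq_one hb]
  · obtain ⟨n, rfl⟩ := Nat.exists_eq_add_of_le' hd
    rw [if_neg (by omega)]
    refine (integral_aliasingSum_sq_le_sqMass_pow_sub hb).trans ?_
    exact_mod_cast pow_sub_pow_le_mul_pow (crossMass_pos hb).le (crossMass_le_sqMass hb)
      (sqMass_sq_sub_crossMass_sq_le hb) n

end UnitCube

section SquaredError

variable {d : ℕ} {ρ ν α : ℝ}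

lemma norm_cov_sub_covApp_sq_le (hd : 1 ≤ d) (hν : 0 < ν) (hα : 0 < α)
    {x : EuclideanSpace ℝ (Fin d)} (hx : x ∈ unitCube d) :
    ‖(cov d ρ ν α x : ℂ) - covApp d ρ ν α x‖ ^ 2 ≤
      errorConst d ρ ν α / d * aliasingSum (beta d ν α) x ^ 2 := by
  have hC : 0 ≤ errorConst d ρ ν α / d :=
    div_nonneg (errorConst_nonneg d ρ ν hα.le) d.cast_nonneg
  rw [← sq_sqrt hC, ← mul_pow]
  exact pow_le_pow_left₀ (norm_nonneg _) (norm_cov_sub_covApp_le hd hν hα hx) 2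

lemma integrableOn_norm_cov_sub_covApp_sq (hd : 1 ≤ d) (hν : 0 < ν) (hα : 0 < α) :
    IntegrableOn (fun x => ‖(cov d ρ ν α x : ℂ) - covApp d ρ ν α x‖ ^ 2) (unitCube d) := by
  have hmeas : AEStronglyMeasurable (fun x => ‖(cov d ρ ν α x : ℂ) - covApp d ρ ν α x‖ ^ 2) :=
    (((integrable_cov hν hα).ofReal.aestronglyMeasurable.sub
      (continuous_covApp hν hα).aestronglyMeasurable).norm.pow 2)
  refine Integrable.mono' ((integrableOn_aliasingSum_sq d (beta d ν α)).const_mul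
    (errorConst d ρ ν α / d)) hmeas.restrict ?_
  filter_upwards [ae_restrict_mem (isCompact_unitCube d).measurableSet] with x hx
  rw [norm_of_nonneg (sq_nonneg _)]
  exact norm_cov_sub_covApp_sq_le hd hν hα hx

theorem integral_norm_cov_sub_covApp_sq_le (hd : 1 ≤ d) (hν : 0 < ν) (hα : 0 < α) :
    ∫ x in unitCube d, ‖(cov d ρ ν α x : ℂ) - covApp d ρ ν α x‖ ^ 2 ≤
      errorConst d ρ ν α * eps d ν α := by
  have hC := errorConst_nonneg d ρ ν hα.le
  calc ∫ x in unitCube d, ‖(cov d ρ ν α x : ℂ) - covApp d ρ ν α x‖ ^ 2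
      ≤ ∫ x in unitCube d, errorConst d ρ ν α / d * aliasingSum (beta d ν α) x ^ 2 :=
        setIntegral_mono_on (integrableOn_norm_cov_sub_covApp_sq hd hν hα)
          ((integrableOn_aliasingSum_sq d _).const_mul _) (isCompact_unitCube d).measurableSet
          fun x hx => norm_cov_sub_covApp_sq_le hd hν hα hx
    _ ≤ errorConst d ρ ν α / d * (d * eps d ν α) := by
        rw [integral_const_mul]
        gcongr
        exact integral_aliasingSum_sq_le hd (beta_pos hd hα)
    _ = errorConst d ρ ν α * eps d ν α := by field_simp

end SquaredError

end WhittleMatern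

end

theorem propositionI2_general (d : ℕ) (hd : 1 ≤ d) (ρ ν α : ℝ) (hν : 0 < ν) (hα : 0 < α) :
    Integrable (WhittleMatern.cov d ρ ν α) ∧
    (∀ u : EuclideanSpace ℝ (Fin d), Summable (WhittleMatern.appTerm d ρ ν α u)) ∧
    IntegrableOn
      (fun x => ‖(WhittleMatern.cov d ρ ν α x : ℂ) - WhittleMatern.covApp d ρ ν α x‖ ^ 2)
      (WhittleMatern.unitCube d) ∧
    ∫ x in WhittleMatern.unitCube d,
        ‖(WhittleMatern.cov d ρ ν α x : ℂ) - WhittleMatern.covApp d ρ ν α x‖ ^ 2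
      ≤ WhittleMatern.errorConst d ρ ν α * WhittleMatern.eps d ν α :=
  ⟨WhittleMatern.integrable_cov hν hα, WhittleMatern.summable_appTerm hν hα,
    WhittleMatern.integrableOn_norm_cov_sub_covApp_sq hd hν hα,
    WhittleMatern.integral_norm_cov_sub_covApp_sq_le hd hν hα⟩

theorem propositionI2 (d : ℕ) (hd : 1 ≤ d) (ρ ν α : ℝ) (hν : 0 < ν) (hα : 0 < α)
    (hρ0 : 0 ≤ ρ) (hρ : ρ ≤ WhittleMatern.rhoMax d ν α) :
    -- `C₀` is integrable, so that its Fourier transform `φ` is a genuine integral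
    Integrable (WhittleMatern.cov d ρ ν α) ∧
    -- the series defining `C_{app,0}` converges absolutely
    (∀ u : EuclideanSpace ℝ (Fin d), Summable (WhittleMatern.appTerm d ρ ν α u)) ∧
    -- the squared error is integrable over the cube, and its integral obeys the bound
    IntegrableOn
      (fun x => ‖(WhittleMatern.cov d ρ ν α x : ℂ) - WhittleMatern.covApp d ρ ν α x‖ ^ 2)
      (WhittleMatern.unitCube d) ∧
    ∫ x in WhittleMatern.unitCube d,
        ‖(WhittleMatern.cov d ρ ν α x : ℂ) - WhittleMatern.covApp d ρ ν α x‖ ^ 2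
      ≤ WhittleMatern.errorConst d ρ ν α * WhittleMatern.eps d ν α := by
  exact propositionI2_general d hd ρ ν α hν hα
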